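/- For real $\tau$ and $x>0$ let $K_{i\tau}(x)=\int_0^\infty e^{-x\cosh u}\cos(\tau u)\,du$ be the modified Bessel (Macdonald) function of purely imaginary index, so that in particular $K_0(x)=\int_0^\infty e^{-x\cosh u}\,du$. For $q>0$ let $L_1(\mathbb{R}_+;K_0(qx)dx)$ be the space of complex-valued measurable functions $f$ on $\mathbb{R}_+=(0,\infty)$ with $\|f\|_{L_1(\mathbb{R}_+;K_0(qx)dx)}=\int_0^\infty |f(x)|K_0(qx)\,dx<\infty$. The Kontorovich-Lebedev transform of $f$ is $$(Ff)(\tau)=\int_0^\infty K_{i\tau}(x)f(x)\,dx,\qquad \tau>0,$$ and the Kontorovich-Lebedev convolution of $f$ and $g$ is $$(f*g)(x)=\frac{1}{2x}\int_0^\infty\!\!\int_0^\infty \exp\left(-\frac{y^2+t^2}{2yt}\,x-\frac{yt}{2x}\right)f(y)g(t)\,dy\,dt,\qquad x>0.$$ **Theorem 1.** Let $0<p\le 1$ and $f,g\in L_1(\mathbb{R}_+;K_0(px)dx)$. Then the double integral defining $(f*g)(x)$ converges absolutely for almost every $x>0$, the convolution $f*g$ belongs to $L_1(\mathbb{R}_+;K_0(p^2x)dx)$,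 and $$\|f*g\|_{L_1(\mathbb{R}_+;K_0(p^2x)dx)}\le \|f\|_{L_1(\mathbb{R}_+;K_0(px)dx)}\,\|g\|_{L_1(\mathbb{R}_+;K_0(px)dx)}.$$ Moreover, for every $\tau>0$ the integrals defining $(Ff)(\tau)$, $(Fg)(\tau)$ and $(F(f*g))(\tau)$ converge absolutely and $$(F(f*g))(\tau)=(Ff)(\tau)\,(Fg)(\tau).$$ If, in addition, $p<1/2$, then for every $x>0$ the double integral defining $(f*g)(x)$ and the integral below converge absolutely and $$(f*g)(x)=\frac{2}{x\pi^2}\int_0^\infty \tau\sinh(\pi\tau)\,K_{i\tau}(x)\,(Ff)(\tau)\,(Fg)(\tau)\,d\tau .$$ -/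

import Mathlib

open MeasureTheory Set

/-- The modified Bessel (Macdonald) function `K_{iτ}(x)` of the second kind with purely imaginary
index `iτ`, for `x > 0`: `K_{iτ}(x) = ∫_0^∞ exp(-x cosh u) cos(τ u) du`.
In particular `macdonaldK 0` is `K_0`. -/
noncomputable def macdonaldK (τ x : ℝ) : ℝ :=
  ∫ u in Ioi (0 : ℝ), Real.exp (-x * Real.cosh u) * Real.cos (τ * u)

/-- The measure `K_0(q x) dx` on `(0, ∞)`, viewed as a measure on `ℝ`.
The space `L_1(ℝ_+; K_0(q x) dx)` is `L_1` of this measure. -/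
noncomputable def macdonaldMeasure (q : ℝ) : Measure ℝ :=
  (volume.restrict (Ioi (0 : ℝ))).withDensity fun x => ENNReal.ofReal (macdonaldK 0 (q * x))

/-- The Kontorovich-Lebedev transform `(F f)(τ) = ∫_0^∞ K_{iτ}(x) f(x) dx`. -/
noncomputable def klTransform (f : ℝ → ℂ) (τ : ℝ) : ℂ :=
  ∫ x in Ioi (0 : ℝ), (macdonaldK τ x : ℂ) * f x

/-- The integrand `exp(-(y² + t²) x / (2 y t) - y t / (2 x)) f(y) g(t)` of the
Kontorovich-Lebedev convolution at the point `x`, as a function of `z = (y, t)`. -/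
noncomputable def klConvIntegrand (f g : ℝ → ℂ) (x : ℝ) (z : ℝ × ℝ) : ℂ :=
  (Real.exp (-((z.1 ^ 2 + z.2 ^ 2) / (2 * z.1 * z.2) * x) - z.1 * z.2 / (2 * x)) : ℂ)
    * (f z.1 * g z.2)

/-- The Kontorovich-Lebedev convolution
`(f * g)(x) = (1 / (2x)) ∫_0^∞ ∫_0^∞ exp(-(y² + t²) x / (2 y t) - y t / (2 x)) f(y) g(t) dy dt`. -/
noncomputable def klConv (f g : ℝ → ℂ) (x : ℝ) : ℂ :=
  1 / (2 * (x : ℂ)) * ∫ z in Ioi (0 : ℝ) ×ˢ Ioi (0 : ℝ), klConvIntegrand f g x z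

/-- The integrand `τ sinh(π τ) K_{iτ}(x) (F f)(τ) (F g)(τ)` of the index integral. -/
noncomputable def klIndexIntegrand (f g : ℝ → ℂ) (x τ : ℝ) : ℂ :=
  ((τ * Real.sinh (Real.pi * τ) * macdonaldK τ x : ℝ) : ℂ) * (klTransform f τ * klTransform g τ)

/-! Two integrals carry the theorem. The first is Macdonald's product formula
(`integral_klKernel_mul_macdonaldK`): the kernel of the convolution, integrated against `K_{iτ}(x)
dx/(2x)`, gives `K_{iτ}(y) K_{iτ}(t)`. With `x = e^s` and `2 K_{iτ}(e^s)` written as a Fourier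
integral in `w`, it becomes a double integral in `(w, s)` that a measure-preserving change of
variables splits into two Macdonald integrals. Fubini then gives the factorization of the transform.
For the norm inequality the formula is used at index 0, after the kernel has been enlarged by
`klKernel_le_klKernel_mul`: replacing `(x, y, t)` by `(p²x, py, pt)` only shrinks the exponent.
Domination at other indices follows from `|K_{iτ}| ≤ K_0` and the monotonicity of `K_0`.

The second integral inverts the first (`integral_mul_sinh_mul_macdonaldK_triple`): integrating `τ
sinh(πτ)` times three Macdonald functions over the index returns the kernel times `π²/4`. Moving the
line of integration of `K_{iτ}` to height `δ < π/2` exhibits `τ e^{δτ} K_{iτ}(x)` and `e^{δτ}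
K_{iτ}(y) K_{iτ}(t)` as Fourier integrals of explicit functions, which are paired by Fubini. As `δ →
π/2` the weight becomes `e^{πτ}`, and on the other side `η = sinh u` reduces the integral to Fourier
inversion of `z⁻¹ exp(-(az + b/z))`. Adding the reflection `τ ↦ -τ` turns `e^{πτ}` into `sinh(πτ)`.

The condition `p < 1/2` enters through `|K_{iτ}(y)| ≤ K_0(y cos δ) e^{-δ|τ|}`: with `cos δ = p` one
has `δ > π/3`, so three such factors beat `e^{π|τ|}` and Fubini applies. It also makes `e^{-y/2}` at
most a constant times `K_0(py)`, which gives convergence of the convolution at every `x`. -/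

/-! ### Shifting the line of integration of `expCosh`. -/

theorem one_add_sq_div_two_le_cosh (s : ℝ) : 1 + s ^ 2 / 2 ≤ Real.cosh s := by
  have h : Real.cosh s = 1 + 2 * Real.sinh (s / 2) ^ 2 := by
    have h1 := Real.cosh_two_mul (s / 2)
    rw [Real.cosh_sq, show 2 * (s / 2) = s by ring] at h1
    linarith
  have h2 : |s / 2| ≤ |Real.sinh (s / 2)| := by
    rw [Real.abs_sinh]
    exact Real.self_le_sinh_iff.2 (abs_nonneg _)
  have h3 := sq_le_sq.2 h2
  linarith

/-- `exp (k |s| - m cosh s)` is integrable for `m > 0`. -/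
theorem integrable_exp_mul_abs_sub_mul_cosh (k : ℝ) {m : ℝ} (hm : 0 < m) :
    Integrable fun s : ℝ => Real.exp (k * |s| - m * Real.cosh s) := by
  have hg : Integrable fun s : ℝ => Real.exp (k ^ 2 / m) * Real.exp (-(m / 4) * s ^ 2) :=
    (integrable_exp_neg_mul_sq (by positivity)).const_mul _
  refine hg.mono' (by fun_prop) (ae_of_all _ fun s => ?_)
  rw [Real.norm_eq_abs, Real.abs_exp, ← Real.exp_add, Real.exp_le_exp]
  have h1 := one_add_sq_div_two_le_cosh s
  have h2 : k * |s| ≤ k ^ 2 / m + m / 4 * s ^ 2 := by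
    have : 0 ≤ (k - m / 2 * |s|) ^ 2 / m := by positivity
    have h3 : (k - m / 2 * |s|) ^ 2 / m = k ^ 2 / m - k * |s| + m / 4 * s ^ 2 := by
      rw [← sq_abs s]; field_simp; ring
    linarith
  nlinarith

/-- The entire function `exp (-(A eᶻ + B e⁻ᶻ) + iτz)`. -/
noncomputable def expCosh (A B : ℂ) (τ : ℝ) (z : ℂ) : ℂ :=
  Complex.exp (-(A * Complex.exp z + B * Complex.exp (-z)) + Complex.I * τ * z)

theorem continuous_expCosh (A B : ℂ) (τ : ℝ) : Continuous (expCosh A B τ) := by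
  unfold expCosh; fun_prop

theorem hasDerivAt_expCosh (A B : ℂ) (τ : ℝ) (z : ℂ) :
    HasDerivAt (expCosh A B τ)
      ((-(A * Complex.exp z - B * Complex.exp (-z)) + Complex.I * τ) * expCosh A B τ z) z := by
  have h1 : HasDerivAt (fun z : ℂ => Complex.exp (-z)) (-Complex.exp (-z)) z := by
    simpa using (hasDerivAt_neg z).cexp
  have := ((((Complex.hasDerivAt_exp z).const_mul A).add (h1.const_mul B)).neg.add
    ((hasDerivAt_id z).const_mul (Complex.I * τ))).cexp
  refine (this.congr_deriv ?_ :)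
  simp only [expCosh, Pi.add_apply, Pi.neg_apply, id]
  ring

theorem norm_expCosh (A B : ℂ) (τ s ψ : ℝ) :
    ‖expCosh A B τ (s + ψ * Complex.I)‖ =
      Real.exp (-((A * Complex.exp (ψ * Complex.I)).re * Real.exp s +
        (B * Complex.exp (-(ψ * Complex.I))).re * Real.exp (-s)) - τ * ψ) := by
  rw [expCosh, Complex.norm_exp]
  congr 1
  rw [Complex.exp_add, neg_add (s : ℂ), Complex.exp_add, ← Complex.ofReal_neg s,
    ← Complex.ofReal_exp, ← Complex.ofReal_exp, mul_left_comm, mul_left_comm B,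
    Complex.add_re, Complex.neg_re, Complex.add_re, Complex.re_ofReal_mul, Complex.re_ofReal_mul]
  simp
  ring

theorem norm_expCosh_le {A B : ℂ} {τ s ψ m : ℝ} (hA : m ≤ (A * Complex.exp (ψ * Complex.I)).re)
    (hB : m ≤ (B * Complex.exp (-(ψ * Complex.I))).re) :
    ‖expCosh A B τ (s + ψ * Complex.I)‖ ≤
      Real.exp (|τ| * |ψ|) * Real.exp (-(2 * m * Real.cosh s)) := by
  rw [norm_expCosh, ← Real.exp_add, Real.exp_le_exp, Real.cosh_eq]
  have h1 := mul_le_mul_of_nonneg_right hA (Real.exp_pos s).le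
  have h2 := mul_le_mul_of_nonneg_right hB (Real.exp_pos (-s)).le
  have h3 := neg_le_abs (τ * ψ)
  rw [abs_mul] at h3
  linarith

/-- The bound depends on the line only through `m` and `|ψ|`, so it can dominate the derivative on
all nearby lines at once. -/
theorem norm_deriv_expCosh_le {A B : ℂ} {τ s ψ m : ℝ}
    (hA : m ≤ (A * Complex.exp (ψ * Complex.I)).re)
    (hB : m ≤ (B * Complex.exp (-(ψ * Complex.I))).re) :
    ‖(-(A * Complex.exp (s + ψ * Complex.I) - B * Complex.exp (-(s + ψ * Complex.I)))
        + Complex.I * τ) * expCosh A B τ (s + ψ * Complex.I)‖ ≤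
      (‖A‖ + ‖B‖ + |τ|) * Real.exp (|τ| * |ψ|) * Real.exp (1 * |s| - 2 * m * Real.cosh s) := by
  have h0 : ‖-(A * Complex.exp (s + ψ * Complex.I) - B * Complex.exp (-(s + ψ * Complex.I)))
        + Complex.I * τ‖ ≤ (‖A‖ + ‖B‖ + |τ|) * Real.exp |s| := by
    refine (norm_add_le _ _).trans ?_
    rw [norm_neg, norm_mul Complex.I, Complex.norm_I, Complex.norm_real, one_mul, add_mul, add_mul]
    refine add_le_add ((norm_sub_le _ _).trans ?_) ?_
    · rw [norm_mul, norm_mul, Complex.norm_exp, Complex.norm_exp]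
      simp only [Complex.add_re, Complex.neg_re, Complex.ofReal_re, Complex.re_ofReal_mul,
        Complex.I_re, mul_zero, add_zero]
      gcongr
      · exact le_abs_self s
      · exact neg_le_abs s
    · exact le_mul_of_one_le_right (abs_nonneg _) (Real.one_le_exp (abs_nonneg s))
  rw [norm_mul, one_mul, sub_eq_add_neg |s|, Real.exp_add]
  calc _ ≤ ((‖A‖ + ‖B‖ + |τ|) * Real.exp |s|) *
        (Real.exp (|τ| * |ψ|) * Real.exp (-(2 * m * Real.cosh s))) := by
        gcongr; exact norm_expCosh_le hA hB
    _ = _ := by ring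

theorem integrable_expCosh {A B : ℂ} {ψ : ℝ} (τ : ℝ)
    (hA : 0 < (A * Complex.exp (ψ * Complex.I)).re)
    (hB : 0 < (B * Complex.exp (-(ψ * Complex.I))).re) :
    Integrable fun s : ℝ => expCosh A B τ (s + ψ * Complex.I) := by
  have hm := lt_min hA hB
  refine ((integrable_exp_mul_abs_sub_mul_cosh 0 (mul_pos two_pos hm)).const_mul
    (Real.exp (|τ| * |ψ|))).mono' ?_ (ae_of_all _ fun s => ?_)
  · exact ((continuous_expCosh A B τ).comp (by fun_prop)).aestronglyMeasurable
  · simpa using norm_expCosh_le (s := s) (τ := τ) (min_le_left _ _) (min_le_right _ _)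

theorem integrable_deriv_expCosh {A B : ℂ} {ψ : ℝ} (τ : ℝ)
    (hA : 0 < (A * Complex.exp (ψ * Complex.I)).re)
    (hB : 0 < (B * Complex.exp (-(ψ * Complex.I))).re) :
    Integrable fun s : ℝ => (-(A * Complex.exp (s + ψ * Complex.I) -
      B * Complex.exp (-(s + ψ * Complex.I))) + Complex.I * τ) *
        expCosh A B τ (s + ψ * Complex.I) := by
  refine ((integrable_exp_mul_abs_sub_mul_cosh 1 (mul_pos two_pos (lt_min hA hB))).const_mul
    ((‖A‖ + ‖B‖ + |τ|) * Real.exp (|τ| * |ψ|))).mono' ?_ (ae_of_all _ fun s => ?_)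
  · have : Continuous fun s : ℝ => expCosh A B τ (s + ψ * Complex.I) :=
      (continuous_expCosh A B τ).comp (by fun_prop)
    exact Continuous.aestronglyMeasurable (by fun_prop)
  · exact norm_deriv_expCosh_le (min_le_left _ _) (min_le_right _ _)

theorem integral_deriv_expCosh {A B : ℂ} {ψ : ℝ} (τ : ℝ)
    (hA : 0 < (A * Complex.exp (ψ * Complex.I)).re)
    (hB : 0 < (B * Complex.exp (-(ψ * Complex.I))).re) :
    ∫ s : ℝ, (-(A * Complex.exp (s + ψ * Complex.I) - B * Complex.exp (-(s + ψ * Complex.I))) +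
      Complex.I * τ) * expCosh A B τ (s + ψ * Complex.I) = 0 := by
  refine integral_eq_zero_of_hasDerivAt_of_integrable
    (f := fun s : ℝ => expCosh A B τ (s + ψ * Complex.I)) (fun s => ?_)
    (integrable_deriv_expCosh τ hA hB) (integrable_expCosh τ hA hB)
  have h1 : HasDerivAt (fun s : ℝ => (s : ℂ) + ψ * Complex.I) 1 s := by
    simpa using ((hasDerivAt_id s).ofReal_comp).add_const ((ψ : ℂ) * Complex.I)
  have h2 := (hasDerivAt_expCosh A B τ (s + ψ * Complex.I)).comp s h1
  rw [mul_one] at h2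
  exact h2

/-- This takes the place of Cauchy's theorem on a rectangle: by holomorphy the derivative in the
height is `I` times the derivative along the line, and the latter integrates to zero. -/
theorem hasDerivAt_integral_expCosh {A B : ℂ} {ψ : ℝ} (τ : ℝ)
    (hA : 0 < (A * Complex.exp (ψ * Complex.I)).re)
    (hB : 0 < (B * Complex.exp (-(ψ * Complex.I))).re) :
    HasDerivAt (fun φ : ℝ => ∫ s : ℝ, expCosh A B τ (s + φ * Complex.I)) 0 ψ := by
  -- A value strictly below both real parts remains a lower bound on a neighbourhood of `ψ`.
  obtain ⟨m, hm, hmin⟩ := exists_between (lt_min hA hB)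
  have hS : ∀ᶠ φ : ℝ in nhds ψ, |φ| < |ψ| + 1 ∧ m < (A * Complex.exp (φ * Complex.I)).re ∧
      m < (B * Complex.exp (-(φ * Complex.I))).re := by
    refine Filter.Eventually.and ?_ (Filter.Eventually.and ?_ ?_)
    · exact (continuous_abs.tendsto ψ).eventually_lt_const (by linarith)
    · have : Continuous fun φ : ℝ => (A * Complex.exp (φ * Complex.I)).re := by fun_prop
      exact (this.tendsto ψ).eventually_const_lt (hmin.trans_le (min_le_left _ _))
    · have : Continuous fun φ : ℝ => (B * Complex.exp (-(φ * Complex.I))).re := by fun_prop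
      exact (this.tendsto ψ).eventually_const_lt (hmin.trans_le (min_le_right _ _))
  let D : ℂ → ℂ := fun z =>
    (-(A * Complex.exp z - B * Complex.exp (-z)) + Complex.I * τ) * expCosh A B τ z
  have hDc : Continuous D := by
    have := continuous_expCosh A B τ
    fun_prop
  have hbound : Integrable fun s : ℝ => (‖A‖ + ‖B‖ + |τ|) * Real.exp (|τ| * (|ψ| + 1)) *
      Real.exp (1 * |s| - 2 * m * Real.cosh s) :=
    (integrable_exp_mul_abs_sub_mul_cosh 1 (mul_pos two_pos hm)).const_mul _
  have hle : ∀ s φ : ℝ, (|φ| < |ψ| + 1 ∧ m < (A * Complex.exp (φ * Complex.I)).re ∧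
      m < (B * Complex.exp (-(φ * Complex.I))).re) → ‖D (s + φ * Complex.I)‖ ≤
      (‖A‖ + ‖B‖ + |τ|) * Real.exp (|τ| * (|ψ| + 1)) *
        Real.exp (1 * |s| - 2 * m * Real.cosh s) := fun s φ h => by
    refine (norm_deriv_expCosh_le h.2.1.le h.2.2.le).trans ?_
    have := h.1.le
    gcongr
  have hmain := hasDerivAt_integral_of_dominated_loc_of_deriv_le (μ := volume) (𝕜 := ℝ) (x₀ := ψ)
    (F := fun φ s : ℝ => expCosh A B τ (s + φ * Complex.I))
    (F' := fun φ s : ℝ => Complex.I * D (s + φ * Complex.I)) hS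
    (Filter.Eventually.of_forall fun φ =>
      ((continuous_expCosh A B τ).comp (by fun_prop)).aestronglyMeasurable)
    (integrable_expCosh τ hA hB)
    ((continuous_const.mul (hDc.comp (by fun_prop))).aestronglyMeasurable)
    (ae_of_all _ fun s φ h => by
      rw [norm_mul, Complex.norm_I, one_mul]; exact hle s φ h) hbound
    (ae_of_all _ fun s φ _ => by
      have h1 : HasDerivAt (fun φ : ℝ => (s : ℂ) + φ * Complex.I) Complex.I φ := by
        simpa using (((hasDerivAt_id φ).ofReal_comp).mul_const Complex.I).const_add (s : ℂ)
      have h2 := (hasDerivAt_expCosh A B τ (s + φ * Complex.I)).comp φ h1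
      rw [mul_comm] at h2
      exact h2)
  have hzero : ∫ s : ℝ, D (s + ψ * Complex.I) = 0 := integral_deriv_expCosh τ hA hB
  have := hmain.2
  rwa [integral_const_mul, hzero, mul_zero] at this

/-- Shifting the line of integration of `expCosh` does not change the integral as long as the
function decays along all intermediate lines. -/
theorem integral_expCosh_shift {A B : ℂ} (τ : ℝ) {ψ : ℝ}
    (h : ∀ φ ∈ uIcc 0 ψ, 0 < (A * Complex.exp (φ * Complex.I)).re ∧
      0 < (B * Complex.exp (-(φ * Complex.I))).re) :
    ∫ s : ℝ, expCosh A B τ (s + ψ * Complex.I) = ∫ s : ℝ, expCosh A B τ s := by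
  -- The mean value inequality with constant 0: a vanishing derivative on the segment forces equal
  -- end values.
  have := (convex_uIcc 0 ψ).norm_image_sub_le_of_norm_hasDerivWithin_le (𝕜 := ℝ) (C := 0)
    (f := fun φ : ℝ => ∫ s : ℝ, expCosh A B τ (s + φ * Complex.I))
    (fun φ hφ => (hasDerivAt_integral_expCosh τ (h φ hφ).1 (h φ hφ).2).hasDerivWithinAt)
    (fun _ _ => by simp) left_mem_uIcc right_mem_uIcc
  rw [zero_mul, norm_le_zero_iff, sub_eq_zero] at this
  simpa using this

/-! ### Fourier integrals and bounds for the Macdonald function. -/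

theorem integrable_expCosh_half {x : ℝ} (hx : 0 < x) (τ : ℝ) :
    Integrable fun s : ℝ => expCosh (x / 2) (x / 2) τ s := by
  have := integrable_expCosh (A := x / 2) (B := x / 2) (ψ := 0) τ (by simpa) (by simpa)
  simpa using this

theorem integral_expCosh_half {x : ℝ} (hx : 0 < x) (τ : ℝ) :
    ∫ s : ℝ, expCosh (x / 2) (x / 2) τ s = 2 * macdonaldK τ x := by
  have h1 := integrable_expCosh_half hx τ
  have h2 : ∫ s : ℝ, expCosh (x / 2) (x / 2) τ (-s : ℝ) = ∫ s : ℝ, expCosh (x / 2) (x / 2) τ s :=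
    integral_neg_eq_self (fun s : ℝ => expCosh (x / 2) (x / 2) τ s) volume
  have h3 : ∀ s : ℝ, expCosh (x / 2) (x / 2) τ s + expCosh (x / 2) (x / 2) τ (-s : ℝ) =
      ((2 * (Real.exp (-x * Real.cosh |s|) * Real.cos (τ * |s|)) : ℝ) : ℂ) := fun s => by
    have h4 : Real.cos (τ * |s|) = Real.cos (τ * s) := by
      rcases abs_choice s with h | h <;> rw [h]
      rw [mul_neg, Real.cos_neg]
    rw [h4, Real.cosh_abs]
    push_cast
    rw [Complex.cos, Complex.cosh, expCosh, expCosh, neg_neg, Complex.exp_add, Complex.exp_add]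
    ring_nf
  have h5 := integral_add h1 h1.comp_neg
  rw [h2, integral_congr_ae (ae_of_all _ h3), integral_complex_ofReal, integral_const_mul,
    integral_comp_abs (f := fun s => Real.exp (-x * Real.cosh s) * Real.cos (τ * s))] at h5
  rw [macdonaldK]
  push_cast at h5
  linear_combination (-1 / 2 : ℂ) * h5

theorem exp_mul_cosh_eq_expCosh (x τ : ℝ) (z : ℂ) :
    Complex.exp (-(x * Complex.cosh z)) * Complex.exp (Complex.I * τ * z) =
      expCosh (x / 2) (x / 2) τ z := by
  rw [expCosh, ← Complex.exp_add, Complex.cosh]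
  ring_nf

theorem half_mul_exp_mul_I_re_pos {x φ : ℝ} (hx : 0 < x) (hφ : |φ| < Real.pi / 2) :
    0 < (x / 2 * Complex.exp (φ * Complex.I)).re ∧
      0 < (x / 2 * Complex.exp (-(φ * Complex.I))).re := by
  have hc : 0 < Real.cos φ := Real.cos_pos_of_mem_Ioo (abs_lt.1 hφ)
  have h1 : (Complex.exp (φ * Complex.I)).re = Real.cos φ := Complex.exp_ofReal_mul_I_re φ
  have h2 : (Complex.exp (-(φ * Complex.I))).re = Real.cos φ := by
    rw [← neg_mul, ← Complex.ofReal_neg, Complex.exp_ofReal_mul_I_re, Real.cos_neg]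
  rw [show (x / 2 : ℂ) = ((x / 2 : ℝ) : ℂ) by push_cast; rfl, Complex.re_ofReal_mul,
    Complex.re_ofReal_mul, h1, h2]
  constructor <;> positivity

/-- The index `iτ` Macdonald function as a Fourier integral along a shifted line. -/
theorem integral_exp_cosh_shift {x δ : ℝ} (hx : 0 < x) (hδ : |δ| < Real.pi / 2) (τ : ℝ) :
    ∫ u : ℝ, expCosh (x / 2) (x / 2) τ (u + δ * Complex.I) = 2 * macdonaldK τ x := by
  rw [← integral_expCosh_half hx]
  refine integral_expCosh_shift τ fun φ hφ => half_mul_exp_mul_I_re_pos hx (lt_of_le_of_lt ?_ hδ)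
  simpa using abs_sub_left_of_mem_uIcc hφ

theorem norm_expCosh_half (x τ u δ : ℝ) :
    ‖expCosh (x / 2) (x / 2) τ (u + δ * Complex.I)‖ =
      Real.exp (-(x * Real.cos δ) * Real.cosh u) * Real.exp (-(τ * δ)) := by
  have h1 : (Complex.exp (δ * Complex.I)).re = Real.cos δ := Complex.exp_ofReal_mul_I_re δ
  have h2 : (Complex.exp (-(δ * Complex.I))).re = Real.cos δ := by
    rw [← neg_mul, ← Complex.ofReal_neg, Complex.exp_ofReal_mul_I_re, Real.cos_neg]
  rw [norm_expCosh, show (x / 2 : ℂ) = ((x / 2 : ℝ) : ℂ) by push_cast; rfl, Complex.re_ofReal_mul,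
    Complex.re_ofReal_mul, h1, h2, ← Real.exp_add, Real.cosh_eq]
  ring_nf

theorem integrable_exp_neg_mul_cosh {x : ℝ} (hx : 0 < x) :
    Integrable fun u : ℝ => Real.exp (-x * Real.cosh u) := by
  simpa [neg_mul] using integrable_exp_mul_abs_sub_mul_cosh 0 hx

theorem macdonaldK_zero_eq (x : ℝ) :
    macdonaldK 0 x = ∫ u in Ioi (0 : ℝ), Real.exp (-x * Real.cosh u) := by
  simp [macdonaldK]

theorem two_mul_macdonaldK_zero (x : ℝ) :
    2 * macdonaldK 0 x = ∫ u : ℝ, Real.exp (-x * Real.cosh u) := by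
  rw [macdonaldK_zero_eq, ← integral_comp_abs (f := fun u => Real.exp (-x * Real.cosh u))]
  simp only [Real.cosh_abs]

theorem macdonaldK_zero_pos {x : ℝ} (hx : 0 < x) : 0 < macdonaldK 0 x := by
  have h := integral_exp_pos (integrable_exp_neg_mul_cosh hx)
  rw [← two_mul_macdonaldK_zero] at h
  linarith

theorem macdonaldK_zero_anti {x y : ℝ} (hx : 0 < x) (hxy : x ≤ y) :
    macdonaldK 0 y ≤ macdonaldK 0 x := by
  have : 2 * macdonaldK 0 y ≤ 2 * macdonaldK 0 x := by
    rw [two_mul_macdonaldK_zero, two_mul_macdonaldK_zero]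
    refine integral_mono (integrable_exp_neg_mul_cosh (hx.trans_le hxy))
      (integrable_exp_neg_mul_cosh hx) fun u => ?_
    have := Real.cosh_pos u
    dsimp only
    gcongr
  linarith

/-- The triangle inequality on the line at height `δ`: the oscillating factor has modulus `e^{-τδ}`
there, and the price is the factor `cos δ` in the argument of `K_0`. -/
theorem exp_mul_abs_macdonaldK_le {x δ : ℝ} (hx : 0 < x) (hδ : |δ| < Real.pi / 2) (τ : ℝ) :
    Real.exp (τ * δ) * |macdonaldK τ x| ≤ macdonaldK 0 (x * Real.cos δ) := by
  have h1 : 2 * |macdonaldK τ x| ≤ 2 * macdonaldK 0 (x * Real.cos δ) * Real.exp (-(τ * δ)) := by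
    have h := norm_integral_le_integral_norm (μ := volume)
      fun u : ℝ => expCosh (x / 2) (x / 2) τ (u + δ * Complex.I)
    rw [integral_exp_cosh_shift hx hδ] at h
    simp only [norm_expCosh_half] at h
    rw [integral_mul_const, ← two_mul_macdonaldK_zero] at h
    simpa using h
  rw [Real.exp_neg] at h1
  have := Real.exp_pos (τ * δ)
  field_simp at h1
  linarith

theorem exp_mul_abs_mul_abs_macdonaldK_le {x δ : ℝ} (hx : 0 < x) (hδ : |δ| < Real.pi / 2)
    (τ : ℝ) : Real.exp (δ * |τ|) * |macdonaldK τ x| ≤ macdonaldK 0 (x * Real.cos δ) := by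
  rcases abs_choice τ with h | h <;> rw [h]
  · rw [mul_comm δ]
    exact exp_mul_abs_macdonaldK_le hx hδ τ
  · rw [mul_neg, mul_comm δ, ← mul_neg, ← Real.cos_neg δ]
    exact exp_mul_abs_macdonaldK_le hx (by rwa [abs_neg]) τ

theorem abs_macdonaldK_le {x : ℝ} (hx : 0 < x) (τ : ℝ) :
    |macdonaldK τ x| ≤ macdonaldK 0 x := by
  simpa using exp_mul_abs_macdonaldK_le (δ := 0) hx (by simp; positivity) τ

theorem stronglyMeasurable_macdonaldK :
    StronglyMeasurable fun z : ℝ × ℝ => macdonaldK z.1 z.2 := by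
  unfold macdonaldK
  refine StronglyMeasurable.integral_prod_right (f := fun (z : ℝ × ℝ) (u : ℝ) =>
    Real.exp (-z.2 * Real.cosh u) * Real.cos (z.1 * u)) ?_
  exact Continuous.stronglyMeasurable (by fun_prop)

theorem measurable_macdonaldK (τ : ℝ) : Measurable (macdonaldK τ) :=
  stronglyMeasurable_macdonaldK.measurable.comp measurable_prodMk_left

theorem measurable_macdonaldK_index (x : ℝ) : Measurable fun τ => macdonaldK τ x :=
  stronglyMeasurable_macdonaldK.measurable.comp measurable_prodMk_right

theorem macdonaldK_neg (τ x : ℝ) : macdonaldK (-τ) x = macdonaldK τ x := by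
  simp [macdonaldK]

/-! ### Macdonald's product formula. -/

theorem integrableOn_Ioi_iff_integrable_comp_exp {E : Type*} [NormedAddCommGroup E]
    [NormedSpace ℝ E] (g : ℝ → E) :
    IntegrableOn g (Ioi 0) ↔ Integrable fun s : ℝ => Real.exp s • g (Real.exp s) := by
  have := integrableOn_image_iff_integrableOn_abs_deriv_smul (s := univ) MeasurableSet.univ
    (fun s _ => (Real.hasDerivAt_exp s).hasDerivWithinAt) Real.exp_injective.injOn g
  simpa [image_univ, Real.range_exp] using this

theorem integral_Ioi_eq_integral_comp_exp {E : Type*} [NormedAddCommGroup E]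
    [NormedSpace ℝ E] (g : ℝ → E) :
    ∫ x in Ioi 0, g x = ∫ s : ℝ, Real.exp s • g (Real.exp s) := by
  have := integral_image_eq_integral_abs_deriv_smul (s := univ) MeasurableSet.univ
    (fun s _ => (Real.hasDerivAt_exp s).hasDerivWithinAt) Real.exp_injective.injOn g
  simpa [image_univ, Real.range_exp] using this

/-- The kernel of the Kontorovich-Lebedev convolution. -/
noncomputable def klKernel (x y t : ℝ) : ℝ :=
  Real.exp (-((y ^ 2 + t ^ 2) / (2 * y * t) * x) - y * t / (2 * x))

/-- The map factors as `(u, v) ↦ (u, u + v)`, a swap, and `(w, u) ↦ (w, u + c w)`. Each preserves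
Lebesgue measure, so no Jacobian has to be computed. -/
theorem measurePreserving_shear {c : ℝ → ℝ} (hc : Measurable c) :
    MeasurePreserving (fun z : ℝ × ℝ => (z.1 + z.2, z.1 + c (z.1 + z.2)))
      (volume.prod volume) (volume.prod volume) := by
  have h1 := measurePreserving_prod_add (volume : Measure ℝ) (volume : Measure ℝ)
  have h2 := (Measure.measurePreserving_swap (μ := (volume : Measure ℝ)) (ν := (volume : Measure ℝ)))
  have h3 := (MeasurePreserving.id (volume : Measure ℝ)).skew_product
    (μc := (volume : Measure ℝ)) (μd := (volume : Measure ℝ)) (g := fun w u : ℝ => u + c w)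
    (by fun_prop) (ae_of_all _ fun w => map_add_right_eq_self _ _)
  exact h3.comp (h2.comp h1)

/-- With `w = u + v`, the coefficient of `e^s` factors as `(y + t e^w)(y + t e^{-w}) / (2yt)`. The
choice `e^s = e^u yt / (y + t e^w)` cancels the first factor and separates the variables `u` and
`v`. -/
theorem klKernel_exponent_shear {y t : ℝ} (hy : 0 < y) (ht : 0 < t) (u v : ℝ) :
    ((y ^ 2 + t ^ 2) / (2 * y * t) + Real.cosh (u + v)) *
        Real.exp (u + Real.log (y * t / (y + t * Real.exp (u + v)))) +
      y * t / 2 * Real.exp (-(u + Real.log (y * t / (y + t * Real.exp (u + v))))) =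
    y * Real.cosh u + t * Real.cosh v := by
  have hu := Real.exp_pos u
  have hv := Real.exp_pos v
  rw [Real.exp_neg, Real.exp_add u (Real.log _), Real.exp_log (by positivity), Real.cosh_eq,
    Real.cosh_eq, Real.cosh_eq, Real.exp_neg, Real.exp_neg, Real.exp_neg, Real.exp_add]
  field_simp
  ring

/-- The Fourier-type double integrand for the product of two Macdonald functions. -/
noncomputable def macdonaldProdIntegrand (y t τ : ℝ) (z : ℝ × ℝ) : ℂ :=
  Complex.exp (-(((y ^ 2 + t ^ 2) / (2 * y * t) + Real.cosh z.1) * Real.exp z.2 +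
    y * t / 2 * Real.exp (-z.2) : ℝ)) * Complex.exp (Complex.I * τ * z.1)

theorem continuous_macdonaldProdIntegrand (y t τ : ℝ) :
    Continuous (macdonaldProdIntegrand y t τ) := by
  unfold macdonaldProdIntegrand; fun_prop

theorem macdonaldProdIntegrand_shear {y t : ℝ} (hy : 0 < y) (ht : 0 < t) (τ : ℝ) (z : ℝ × ℝ) :
    macdonaldProdIntegrand y t τ
      (z.1 + z.2, z.1 + Real.log (y * t / (y + t * Real.exp (z.1 + z.2)))) =
    expCosh (y / 2) (y / 2) τ z.1 * expCosh (t / 2) (t / 2) τ z.2 := by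
  rw [macdonaldProdIntegrand, klKernel_exponent_shear hy ht, ← exp_mul_cosh_eq_expCosh,
    ← exp_mul_cosh_eq_expCosh, ← Complex.exp_add, ← Complex.exp_add, ← Complex.exp_add,
    ← Complex.exp_add]
  push_cast
  ring_nf

theorem integrable_macdonaldProdIntegrand {y t : ℝ} (hy : 0 < y) (ht : 0 < t) (τ : ℝ) :
    Integrable (macdonaldProdIntegrand y t τ) (volume.prod volume) := by
  have hT := measurePreserving_shear
    (c := fun w => Real.log (y * t / (y + t * Real.exp w))) (by fun_prop)
  rw [← hT.integrable_comp (continuous_macdonaldProdIntegrand y t τ).aestronglyMeasurable]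
  refine ((integrable_expCosh_half hy τ).mul_prod (integrable_expCosh_half ht τ)).congr
    (ae_of_all _ fun z => ?_)
  exact (macdonaldProdIntegrand_shear hy ht τ z).symm

theorem integral_macdonaldProdIntegrand {y t : ℝ} (hy : 0 < y) (ht : 0 < t) (τ : ℝ) :
    ∫ z, macdonaldProdIntegrand y t τ z ∂(volume.prod volume) =
      4 * (macdonaldK τ y * macdonaldK τ t) := by
  have hT := measurePreserving_shear
    (c := fun w => Real.log (y * t / (y + t * Real.exp w))) (by fun_prop)
  rw [← hT.map_eq, integral_map hT.measurable.aemeasurable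
    (continuous_macdonaldProdIntegrand y t τ).aestronglyMeasurable]
  simp only [macdonaldProdIntegrand_shear hy ht]
  rw [integral_prod_mul (fun u : ℝ => expCosh (y / 2) (y / 2) τ u)
    (fun v : ℝ => expCosh (t / 2) (t / 2) τ v), integral_expCosh_half hy, integral_expCosh_half ht]
  ring

theorem klKernel_exp (s y t : ℝ) : klKernel (Real.exp s) y t =
    Real.exp (-((y ^ 2 + t ^ 2) / (2 * y * t) * Real.exp s + y * t / 2 * Real.exp (-s))) := by
  rw [klKernel, Real.exp_neg s]
  congr 1
  field_simp
  ring

/-- The other order of integration: for fixed `s` the factor `klKernel` comes out and the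
`w`-integral is the Fourier integral of `K_{iτ}(e^s)`. -/
theorem integral_macdonaldProdIntegrand_fst (y t τ s : ℝ) :
    ∫ w, macdonaldProdIntegrand y t τ (w, s) =
      2 * ((klKernel (Real.exp s) y t * macdonaldK τ (Real.exp s) : ℝ) : ℂ) := by
  have h : ∀ w : ℝ, macdonaldProdIntegrand y t τ (w, s) =
      (klKernel (Real.exp s) y t : ℂ) *
        expCosh ((Real.exp s : ℝ) / 2) ((Real.exp s : ℝ) / 2) τ w := fun w => by
    rw [macdonaldProdIntegrand, klKernel_exp, ← exp_mul_cosh_eq_expCosh, Complex.ofReal_exp,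
      ← Complex.exp_add, ← Complex.exp_add, ← Complex.exp_add]
    push_cast
    ring_nf
  simp only [h]
  rw [integral_const_mul, integral_expCosh_half (Real.exp_pos s)]
  push_cast
  ring

theorem integrable_klKernel_exp_mul_macdonaldK {y t : ℝ} (hy : 0 < y) (ht : 0 < t) (τ : ℝ) :
    Integrable fun s => klKernel (Real.exp s) y t * macdonaldK τ (Real.exp s) := by
  have h := (integrable_macdonaldProdIntegrand hy ht τ).integral_prod_right
  simp only [integral_macdonaldProdIntegrand_fst] at h
  have h2 := (h.const_mul (1 / 2)).re
  refine h2.congr (ae_of_all _ fun s => ?_)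
  simp

theorem integral_klKernel_exp_mul_macdonaldK {y t : ℝ} (hy : 0 < y) (ht : 0 < t) (τ : ℝ) :
    ∫ s, klKernel (Real.exp s) y t * macdonaldK τ (Real.exp s) =
      2 * (macdonaldK τ y * macdonaldK τ t) := by
  have h := integral_prod_symm _ (integrable_macdonaldProdIntegrand hy ht τ)
  simp only [integral_macdonaldProdIntegrand_fst] at h
  rw [integral_macdonaldProdIntegrand hy ht, integral_const_mul, integral_complex_ofReal] at h
  norm_cast at h
  linarith

theorem integrableOn_klKernel_mul_macdonaldK {y t : ℝ} (hy : 0 < y) (ht : 0 < t) (τ : ℝ) :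
    IntegrableOn (fun x => klKernel x y t / (2 * x) * macdonaldK τ x) (Ioi 0) := by
  rw [integrableOn_Ioi_iff_integrable_comp_exp]
  refine ((integrable_klKernel_exp_mul_macdonaldK hy ht τ).const_mul (1 / 2)).congr
    (ae_of_all _ fun s => ?_)
  have := Real.exp_ne_zero s
  simp only [smul_eq_mul]
  field_simp

/-- Macdonald's product formula. -/
theorem integral_klKernel_mul_macdonaldK {y t : ℝ} (hy : 0 < y) (ht : 0 < t) (τ : ℝ) :
    ∫ x in Ioi 0, klKernel x y t / (2 * x) * macdonaldK τ x =
      macdonaldK τ y * macdonaldK τ t := by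
  have h : ∀ s, Real.exp s • (klKernel (Real.exp s) y t / (2 * Real.exp s) *
      macdonaldK τ (Real.exp s)) =
      (1 / 2) * (klKernel (Real.exp s) y t * macdonaldK τ (Real.exp s)) := fun s => by
    have := Real.exp_ne_zero s
    simp only [smul_eq_mul]
    field_simp
  rw [integral_Ioi_eq_integral_comp_exp]
  simp only [h]
  rw [integral_const_mul, integral_klKernel_exp_mul_macdonaldK hy ht]
  ring

/-! ### The weighted spaces, the norm inequality and the factorization of the transform. -/

theorem klKernel_pos (x y t : ℝ) : 0 < klKernel x y t := Real.exp_pos _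

theorem measurable_klKernel : Measurable fun z : ℝ × ℝ × ℝ => klKernel z.1 z.2.1 z.2.2 := by
  unfold klKernel; fun_prop

/-- The rescaling fixes `yt/(2x)` and multiplies the other term of the exponent by `p² ≤ 1`. -/
theorem klKernel_le_klKernel_mul {p x y t : ℝ} (hp0 : 0 < p) (hp1 : p ≤ 1) (hx : 0 < x)
    (hy : 0 < y) (ht : 0 < t) : klKernel x y t ≤ klKernel (p ^ 2 * x) (p * y) (p * t) := by
  unfold klKernel
  rw [Real.exp_le_exp]
  have h1 : (p * y * (p * t)) / (2 * (p ^ 2 * x)) = y * t / (2 * x) := by field_simp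
  have h2 : ((p * y) ^ 2 + (p * t) ^ 2) / (2 * (p * y) * (p * t)) * (p ^ 2 * x) =
      p ^ 2 * ((y ^ 2 + t ^ 2) / (2 * y * t) * x) := by field_simp
  rw [h1, h2]
  have h3 : p ^ 2 ≤ 1 := pow_le_one₀ hp0.le hp1
  have h4 : 0 ≤ (y ^ 2 + t ^ 2) / (2 * y * t) * x := by positivity
  nlinarith

/-- Since `dx/x` is invariant under `x ↦ p²x`, the enlarged kernel integrates exactly, by the
product formula at index 0 and arguments `py`, `pt`. -/
theorem lintegral_klKernel_mul_macdonaldK_le {p y t : ℝ} (hp0 : 0 < p) (hp1 : p ≤ 1)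
    (hy : 0 < y) (ht : 0 < t) :
    ∫⁻ x in Ioi 0, ENNReal.ofReal (macdonaldK 0 (p ^ 2 * x) * (klKernel x y t / (2 * x))) ≤
      ENNReal.ofReal (macdonaldK 0 (p * y)) * ENNReal.ofReal (macdonaldK 0 (p * t)) := by
  have hp2 : 0 < p ^ 2 := by positivity
  have hy' := mul_pos hp0 hy
  have ht' := mul_pos hp0 ht
  have hint := integrableOn_klKernel_mul_macdonaldK hy' ht' 0
  have hint2 := (integrableOn_Ioi_comp_mul_left_iff
    (fun x => klKernel x (p * y) (p * t) / (2 * x) * macdonaldK 0 x) 0 hp2).2 (by simpa using hint)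
  have heq := integral_comp_mul_left_Ioi
    (fun x => klKernel x (p * y) (p * t) / (2 * x) * macdonaldK 0 x) 0 hp2
  rw [mul_zero, integral_klKernel_mul_macdonaldK hy' ht', smul_eq_mul,
    eq_inv_mul_iff_mul_eq₀ hp2.ne', ← integral_const_mul] at heq
  rw [← ENNReal.ofReal_mul (macdonaldK_zero_pos hy').le, ← heq,
    ofReal_integral_eq_lintegral_ofReal (hint2.const_mul _)]
  · refine setLIntegral_mono' measurableSet_Ioi fun x (hx : 0 < x) => ENNReal.ofReal_le_ofReal ?_
    have h1 := klKernel_le_klKernel_mul hp0 hp1 hx hy ht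
    have h2 := macdonaldK_zero_pos (mul_pos hp2 hx)
    calc _ ≤ macdonaldK 0 (p ^ 2 * x) *
          (klKernel (p ^ 2 * x) (p * y) (p * t) / (2 * x)) := by gcongr
      _ = _ := by field_simp
  · refine (ae_restrict_iff' measurableSet_Ioi).2 (ae_of_all _ fun x (hx : 0 < x) => ?_)
    have h1 := klKernel_pos (p ^ 2 * x) (p * y) (p * t)
    have h2 := macdonaldK_zero_pos (mul_pos hp2 hx)
    simp only [Pi.zero_apply]
    positivity

/-- Positivity of the density lets measurability pass from the weighted measure back to Lebesgue
measure on the half-line. -/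
theorem absolutelyContinuous_macdonaldMeasure {q : ℝ} (hq : 0 < q) :
    volume.restrict (Ioi (0 : ℝ)) ≪ macdonaldMeasure q := by
  refine withDensity_absolutelyContinuous' ?_ ?_
  · exact ((measurable_macdonaldK 0).comp (measurable_const_mul q)).ennreal_ofReal.aemeasurable
  · refine (ae_restrict_iff' measurableSet_Ioi).2 (ae_of_all _ fun x (hx : 0 < x) => ?_)
    simpa using macdonaldK_zero_pos (mul_pos hq hx)

theorem eLpNorm_one_macdonaldMeasure (f : ℝ → ℂ) (q : ℝ) :
    eLpNorm f 1 (macdonaldMeasure q) =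
      ∫⁻ x in Ioi 0, ENNReal.ofReal (macdonaldK 0 (q * x)) * ‖f x‖ₑ := by
  rw [eLpNorm_one_eq_lintegral_enorm, macdonaldMeasure,
    lintegral_withDensity_eq_lintegral_mul_non_measurable]
  · rfl
  · exact ((measurable_macdonaldK 0).comp (measurable_const_mul q)).ennreal_ofReal
  · exact ae_of_all _ fun _ => ENNReal.ofReal_lt_top

theorem aestronglyMeasurable_of_macdonaldMeasure {f : ℝ → ℂ} {q : ℝ} (hq : 0 < q)
    (hf : AEStronglyMeasurable f (macdonaldMeasure q)) :
    AEStronglyMeasurable f (volume.restrict (Ioi 0)) :=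
  hf.mono_ac (absolutelyContinuous_macdonaldMeasure hq)

theorem integrableOn_macdonaldK_zero_mul {f : ℝ → ℂ} {q : ℝ} (hq : 0 < q)
    (hf : MemLp f 1 (macdonaldMeasure q)) :
    IntegrableOn (fun x => (macdonaldK 0 (q * x) : ℂ) * f x) (Ioi 0) := by
  refine ⟨?_, ?_⟩
  · refine AEStronglyMeasurable.mul ?_ (aestronglyMeasurable_of_macdonaldMeasure hq hf.1)
    exact (Complex.measurable_ofReal.comp
      ((measurable_macdonaldK 0).comp (measurable_const_mul q))).aestronglyMeasurable
  · have h := hf.2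
    rw [eLpNorm_one_macdonaldMeasure] at h
    refine lt_of_le_of_lt (setLIntegral_mono' measurableSet_Ioi fun x (hx : 0 < x) => ?_) h
    rw [enorm_mul, ← ofReal_norm, Complex.norm_of_nonneg (macdonaldK_zero_pos (mul_pos hq hx)).le]

theorem integrableOn_macdonaldK_mul {f : ℝ → ℂ} {q : ℝ} (hq : 0 < q) (hq1 : q ≤ 1)
    (hf : MemLp f 1 (macdonaldMeasure q)) (τ : ℝ) :
    IntegrableOn (fun x => (macdonaldK τ x : ℂ) * f x) (Ioi 0) := by
  refine Integrable.mono (integrableOn_macdonaldK_zero_mul hq hf) ?_ ?_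
  · refine AEStronglyMeasurable.mul ?_ (aestronglyMeasurable_of_macdonaldMeasure hq hf.1)
    exact (Complex.measurable_ofReal.comp (measurable_macdonaldK τ)).aestronglyMeasurable
  · refine (ae_restrict_iff' measurableSet_Ioi).2 (ae_of_all _ fun x (hx : 0 < x) => ?_)
    rw [norm_mul, norm_mul, Complex.norm_real, Complex.norm_real]
    gcongr
    exact (abs_macdonaldK_le hx τ).trans ((macdonaldK_zero_anti (mul_pos hq hx)
      (mul_le_of_le_one_left hx.le hq1)).trans (le_abs_self _))

theorem volume_restrict_Ioi_prod_Ioi : (volume : Measure (ℝ × ℝ)).restrict (Ioi 0 ×ˢ Ioi 0) =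
    ((volume : Measure ℝ).restrict (Ioi 0)).prod ((volume : Measure ℝ).restrict (Ioi 0)) := by
  rw [Measure.volume_eq_prod, Measure.prod_restrict]

theorem klConvIntegrand_eq (f g : ℝ → ℂ) (x : ℝ) (z : ℝ × ℝ) :
    klConvIntegrand f g x z = (klKernel x z.1 z.2 : ℂ) * (f z.1 * g z.2) := rfl

section Young

variable {p : ℝ} {f g : ℝ → ℂ}

theorem aestronglyMeasurable_klConvIntegrand
    (hf : AEStronglyMeasurable f (volume.restrict (Ioi 0)))
    (hg : AEStronglyMeasurable g (volume.restrict (Ioi 0))) :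
    AEStronglyMeasurable (fun w : ℝ × ℝ × ℝ => klConvIntegrand f g w.1 w.2)
      ((volume.restrict (Ioi 0)).prod
        ((volume.restrict (Ioi 0)).prod (volume.restrict (Ioi 0)))) := by
  simp only [klConvIntegrand_eq]
  refine AEStronglyMeasurable.mul ?_ (AEStronglyMeasurable.comp_snd (hf.comp_fst.mul hg.comp_snd))
  exact (Complex.measurable_ofReal.comp measurable_klKernel).aestronglyMeasurable

theorem aestronglyMeasurable_macdonaldK_mul_klConvIntegrand (τ q : ℝ)
    (hf : AEStronglyMeasurable f (volume.restrict (Ioi 0)))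
    (hg : AEStronglyMeasurable g (volume.restrict (Ioi 0))) :
    AEStronglyMeasurable (fun w : ℝ × ℝ × ℝ =>
      ((macdonaldK τ (q * w.1) / (2 * w.1) : ℝ) : ℂ) * klConvIntegrand f g w.1 w.2)
      ((volume.restrict (Ioi 0)).prod
        ((volume.restrict (Ioi 0)).prod (volume.restrict (Ioi 0)))) := by
  refine AEStronglyMeasurable.mul ?_ (aestronglyMeasurable_klConvIntegrand hf hg)
  refine (Complex.measurable_ofReal.comp (Measurable.div ?_ (by fun_prop))).aestronglyMeasurable
  exact (measurable_macdonaldK τ).comp (by fun_prop)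

/-- By Tonelli the `x`-integral is taken first. This single estimate yields the almost everywhere
convergence, the norm inequality and the domination for Fubini. -/
theorem lintegral_enorm_klConvIntegrand_le (hp0 : 0 < p) (hp1 : p ≤ 1)
    (hf : MemLp f 1 (macdonaldMeasure p)) (hg : MemLp g 1 (macdonaldMeasure p)) :
    ∫⁻ w, ‖((macdonaldK 0 (p ^ 2 * w.1) / (2 * w.1) : ℝ) : ℂ) * klConvIntegrand f g w.1 w.2‖ₑ
      ∂((volume.restrict (Ioi (0 : ℝ))).prod
        ((volume.restrict (Ioi (0 : ℝ))).prod (volume.restrict (Ioi (0 : ℝ))))) ≤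
      eLpNorm f 1 (macdonaldMeasure p) * eLpNorm g 1 (macdonaldMeasure p) := by
  have hf' := aestronglyMeasurable_of_macdonaldMeasure hp0 hf.1
  have hg' := aestronglyMeasurable_of_macdonaldMeasure hp0 hg.1
  have hK : AEMeasurable (fun x => ENNReal.ofReal (macdonaldK 0 (p * x)))
      (volume.restrict (Ioi (0 : ℝ))) :=
    ((measurable_macdonaldK 0).comp (measurable_const_mul p)).ennreal_ofReal.aemeasurable
  rw [lintegral_prod_symm _
    (aestronglyMeasurable_macdonaldK_mul_klConvIntegrand 0 (p ^ 2) hf' hg').enorm,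
    eLpNorm_one_macdonaldMeasure, eLpNorm_one_macdonaldMeasure,
    ← lintegral_prod_mul (f := fun x => ENNReal.ofReal (macdonaldK 0 (p * x)) * ‖f x‖ₑ)
      (g := fun x => ENNReal.ofReal (macdonaldK 0 (p * x)) * ‖g x‖ₑ)
      (hK.mul hf'.enorm) (hK.mul hg'.enorm), ← volume_restrict_Ioi_prod_Ioi]
  refine setLIntegral_mono' (measurableSet_Ioi.prod measurableSet_Ioi) ?_
  rintro ⟨y, t⟩ ⟨hy : 0 < y, ht : 0 < t⟩
  calc _ = ∫⁻ x in Ioi 0, ENNReal.ofReal (macdonaldK 0 (p ^ 2 * x) * (klKernel x y t / (2 * x)))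
        * (‖f y‖ₑ * ‖g t‖ₑ) := by
        refine setLIntegral_congr_fun measurableSet_Ioi fun x (hx : 0 < x) => ?_
        have h1 := klKernel_pos x y t
        have h2 := macdonaldK_zero_pos (mul_pos (pow_pos hp0 2) hx)
        simp only [klConvIntegrand_eq]
        rw [← mul_assoc, ← Complex.ofReal_mul, enorm_mul, enorm_mul, ← ofReal_norm (Complex.ofReal _),
          Complex.norm_of_nonneg (by positivity)]
        congr 2
        ring
    _ = (∫⁻ x in Ioi 0, ENNReal.ofReal (macdonaldK 0 (p ^ 2 * x) * (klKernel x y t / (2 * x))))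
        * (‖f y‖ₑ * ‖g t‖ₑ) := lintegral_mul_const' _ _ (by finiteness)
    _ ≤ (ENNReal.ofReal (macdonaldK 0 (p * y)) * ENNReal.ofReal (macdonaldK 0 (p * t)))
        * (‖f y‖ₑ * ‖g t‖ₑ) := by
        gcongr
        exact lintegral_klKernel_mul_macdonaldK_le hp0 hp1 hy ht
    _ = _ := by ring

theorem integrable_macdonaldK_zero_mul_klConvIntegrand (hp0 : 0 < p) (hp1 : p ≤ 1)
    (hf : MemLp f 1 (macdonaldMeasure p)) (hg : MemLp g 1 (macdonaldMeasure p)) :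
    Integrable (fun w : ℝ × ℝ × ℝ =>
      ((macdonaldK 0 (p ^ 2 * w.1) / (2 * w.1) : ℝ) : ℂ) * klConvIntegrand f g w.1 w.2)
      ((volume.restrict (Ioi 0)).prod
        ((volume.restrict (Ioi 0)).prod (volume.restrict (Ioi 0)))) :=
  ⟨aestronglyMeasurable_macdonaldK_mul_klConvIntegrand 0 (p ^ 2)
    (aestronglyMeasurable_of_macdonaldMeasure hp0 hf.1)
    (aestronglyMeasurable_of_macdonaldMeasure hp0 hg.1),
    (lintegral_enorm_klConvIntegrand_le hp0 hp1 hf hg).trans_lt (ENNReal.mul_lt_top hf.2 hg.2)⟩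

theorem ae_integrableOn_klConvIntegrand (hp0 : 0 < p) (hp1 : p ≤ 1)
    (hf : MemLp f 1 (macdonaldMeasure p)) (hg : MemLp g 1 (macdonaldMeasure p)) :
    ∀ᵐ x ∂(volume.restrict (Ioi (0 : ℝ))),
      IntegrableOn (klConvIntegrand f g x) (Ioi (0 : ℝ) ×ˢ Ioi (0 : ℝ)) := by
  have h := (integrable_macdonaldK_zero_mul_klConvIntegrand hp0 hp1 hf hg).prod_right_ae
  filter_upwards [h, ae_restrict_mem measurableSet_Ioi] with x hx (hx0 : 0 < x)
  have h2 := macdonaldK_zero_pos (mul_pos (pow_pos hp0 2) hx0)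
  rw [IntegrableOn, volume_restrict_Ioi_prod_Ioi]
  refine (integrable_const_mul_iff (IsUnit.mk0 _ ?_) _).1 hx
  exact Complex.ofReal_ne_zero.2 (by positivity)

theorem aestronglyMeasurable_klConv
    (hf : AEStronglyMeasurable f (volume.restrict (Ioi 0)))
    (hg : AEStronglyMeasurable g (volume.restrict (Ioi 0))) :
    AEStronglyMeasurable (klConv f g) (volume.restrict (Ioi 0)) := by
  unfold klConv
  refine AEStronglyMeasurable.mul (Measurable.aestronglyMeasurable (by fun_prop)) ?_
  rw [volume_restrict_Ioi_prod_Ioi]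
  exact (aestronglyMeasurable_klConvIntegrand hf hg).integral_prod_right'

theorem macdonaldK_mul_klConv (f g : ℝ → ℂ) (τ q x : ℝ) :
    (macdonaldK τ (q * x) : ℂ) * klConv f g x =
      ∫ z, ((macdonaldK τ (q * x) / (2 * x) : ℝ) : ℂ) * klConvIntegrand f g x z
        ∂((volume.restrict (Ioi (0 : ℝ))).prod (volume.restrict (Ioi (0 : ℝ)))) := by
  rw [klConv, volume_restrict_Ioi_prod_Ioi, integral_const_mul]
  push_cast
  ring

theorem eLpNorm_klConv_le (hp0 : 0 < p) (hp1 : p ≤ 1)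
    (hf : MemLp f 1 (macdonaldMeasure p)) (hg : MemLp g 1 (macdonaldMeasure p)) :
    eLpNorm (klConv f g) 1 (macdonaldMeasure (p ^ 2)) ≤
      eLpNorm f 1 (macdonaldMeasure p) * eLpNorm g 1 (macdonaldMeasure p) := by
  refine le_trans ?_ (lintegral_enorm_klConvIntegrand_le hp0 hp1 hf hg)
  rw [eLpNorm_one_macdonaldMeasure, lintegral_prod _
    (integrable_macdonaldK_zero_mul_klConvIntegrand hp0 hp1 hf hg).1.enorm]
  refine setLIntegral_mono' measurableSet_Ioi fun x (hx : 0 < x) => ?_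
  have h2 := macdonaldK_zero_pos (mul_pos (pow_pos hp0 2) hx)
  refine le_trans (le_of_eq ?_) (enorm_integral_le_lintegral_enorm _)
  rw [← macdonaldK_mul_klConv, enorm_mul, ← ofReal_norm (Complex.ofReal _),
    Complex.norm_of_nonneg h2.le]

theorem memLp_klConv (hp0 : 0 < p) (hp1 : p ≤ 1)
    (hf : MemLp f 1 (macdonaldMeasure p)) (hg : MemLp g 1 (macdonaldMeasure p)) :
    MemLp (klConv f g) 1 (macdonaldMeasure (p ^ 2)) :=
  ⟨(aestronglyMeasurable_klConv (aestronglyMeasurable_of_macdonaldMeasure hp0 hf.1)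
    (aestronglyMeasurable_of_macdonaldMeasure hp0 hg.1)).mono_ac
      (withDensity_absolutelyContinuous _ _),
    (eLpNorm_klConv_le hp0 hp1 hf hg).trans_lt (ENNReal.mul_lt_top hf.2 hg.2)⟩

theorem klTransform_klConv (hp0 : 0 < p) (hp1 : p ≤ 1)
    (hf : MemLp f 1 (macdonaldMeasure p)) (hg : MemLp g 1 (macdonaldMeasure p)) (τ : ℝ) :
    klTransform (klConv f g) τ = klTransform f τ * klTransform g τ := by
  -- Dominated by the integrand of index 0, because `|K_{iτ}(x)| ≤ K_0(x) ≤ K_0(p²x)`.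
  have hint : Integrable (fun w : ℝ × ℝ × ℝ =>
      ((macdonaldK τ (1 * w.1) / (2 * w.1) : ℝ) : ℂ) * klConvIntegrand f g w.1 w.2)
      ((volume.restrict (Ioi 0)).prod
        ((volume.restrict (Ioi 0)).prod (volume.restrict (Ioi 0)))) := by
    refine (integrable_macdonaldK_zero_mul_klConvIntegrand hp0 hp1 hf hg).mono
      (aestronglyMeasurable_macdonaldK_mul_klConvIntegrand τ 1
        (aestronglyMeasurable_of_macdonaldMeasure hp0 hf.1)
        (aestronglyMeasurable_of_macdonaldMeasure hp0 hg.1)) ?_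
    have h : ∀ᵐ w : ℝ × ℝ × ℝ ∂((volume.restrict (Ioi 0)).prod
        ((volume.restrict (Ioi 0)).prod (volume.restrict (Ioi 0)))), w.1 ∈ Ioi (0 : ℝ) :=
      Measure.quasiMeasurePreserving_fst.ae (ae_restrict_mem measurableSet_Ioi)
    filter_upwards [h] with w hw
    have hw : 0 < w.1 := hw
    rw [norm_mul, norm_mul, Complex.norm_real, Complex.norm_real, norm_div, norm_div, one_mul]
    gcongr
    exact (abs_macdonaldK_le hw τ).trans ((macdonaldK_zero_anti (mul_pos (pow_pos hp0 2) hw)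
      (mul_le_of_le_one_left hw.le (pow_le_one₀ hp0.le hp1))).trans (le_abs_self _))
  have h1 : klTransform (klConv f g) τ = ∫ x in Ioi (0 : ℝ), ∫ z,
      ((macdonaldK τ (1 * x) / (2 * x) : ℝ) : ℂ) * klConvIntegrand f g x z
        ∂((volume.restrict (Ioi (0 : ℝ))).prod (volume.restrict (Ioi (0 : ℝ)))) := by
    refine setIntegral_congr_fun measurableSet_Ioi fun x _ => ?_
    have := macdonaldK_mul_klConv f g τ 1 x
    simpa only [one_mul] using this
  rw [h1, integral_integral_swap hint, klTransform, klTransform, ← integral_prod_mul,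
    ← volume_restrict_Ioi_prod_Ioi]
  refine setIntegral_congr_fun (measurableSet_Ioi.prod measurableSet_Ioi) ?_
  rintro ⟨y, t⟩ ⟨hy : 0 < y, ht : 0 < t⟩
  have h2 : ∀ x : ℝ, ((macdonaldK τ (1 * x) / (2 * x) : ℝ) : ℂ) * klConvIntegrand f g x (y, t) =
      ((klKernel x y t / (2 * x) * macdonaldK τ x : ℝ) : ℂ) * (f y * g t) := fun x => by
    rw [klConvIntegrand_eq, one_mul]
    push_cast
    ring
  simp only [h2]
  rw [integral_mul_const, integral_complex_ofReal, integral_klKernel_mul_macdonaldK hy ht]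
  push_cast
  ring

end Young

/-! ### Fourier inversion and the transform of `τ e^{δτ} K_{iτ}(x)`. -/

open FourierTransform in
/-- Fourier inversion with the kernel `exp (iτu)`. -/
theorem integral_mul_exp_neg_of_integral_mul_exp {h H : ℝ → ℂ} (hint : Integrable h) {v : ℝ}
    (hc : ContinuousAt h v) (hH : ∀ τ : ℝ, ∫ u : ℝ, h u * Complex.exp (Complex.I * τ * u) = H τ)
    (hHi : Integrable H) :
    ∫ τ : ℝ, H τ * Complex.exp (-(Complex.I * τ * v)) = 2 * Real.pi * h v := by
  have hpi : (2 * Real.pi : ℝ) ≠ 0 := by positivity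
  have h1 : 𝓕⁻ h = fun w : ℝ => H (2 * Real.pi * w) := by
    ext w
    rw [Real.fourierInv_eq', ← hH]
    refine integral_congr_ae (ae_of_all _ fun u => ?_)
    simp only [smul_eq_mul, RCLike.inner_apply, conj_trivial]
    rw [mul_comm]
    congr 2
    push_cast
    ring
  -- Inversion asks for an integrable `𝓕 h`, which is `H` reflected and rescaled.
  have h2 : 𝓕 (𝓕⁻ h) v = h v := hint.fourier_fourierInv_eq (by
    have h3 : 𝓕 h = fun w : ℝ => H (-(2 * Real.pi) * w) := by
      ext w
      have h4 := Real.fourierInv_eq_fourier_neg h (-w)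
      rw [neg_neg] at h4
      rw [← h4, h1]
      ring_nf
    rw [h3]
    exact hHi.comp_mul_left' (neg_ne_zero.2 hpi)) hc
  rw [← h2, h1, Real.fourier_eq']
  have h3 := Measure.integral_comp_mul_left
    (fun τ : ℝ => H τ * Complex.exp (-(Complex.I * τ * v))) (2 * Real.pi)
  rw [abs_of_pos (by positivity), Complex.real_smul, Complex.ofReal_inv, eq_inv_mul_iff_mul_eq₀
    (Complex.ofReal_ne_zero.2 hpi)] at h3
  rw [← h3]
  push_cast
  congr 1
  refine integral_congr_ae (ae_of_all _ fun u => ?_)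
  simp only [smul_eq_mul, RCLike.inner_apply, conj_trivial]
  rw [mul_comm]
  congr 2
  push_cast
  ring

theorem integrable_inv_cosh : Integrable fun u : ℝ => (Real.cosh u)⁻¹ := by
  refine (integrable_inv_one_add_sq.const_mul 2).mono' ?_ (ae_of_all _ fun u => ?_)
  · exact (Real.measurable_cosh.inv).aestronglyMeasurable
  · have h1 := one_add_sq_div_two_le_cosh u
    rw [Real.norm_of_nonneg (inv_nonneg.2 (Real.cosh_pos u).le), ← div_eq_mul_inv,
      inv_le_comm₀ (Real.cosh_pos u) (by positivity), inv_div]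
    linarith

theorem integrable_exp_neg_mul_abs {c : ℝ} (hc : 0 < c) :
    Integrable fun τ : ℝ => Real.exp (-(c * |τ|)) := by
  refine (integrable_inv_cosh.comp_mul_left' hc.ne').mono' (by fun_prop) (ae_of_all _ fun τ => ?_)
  rw [Real.norm_eq_abs, Real.abs_exp, Real.exp_neg]
  have h := Real.sinh_nonneg_iff.2 (abs_nonneg (c * τ))
  have h2 := Real.cosh_add_sinh |c * τ|
  rw [Real.cosh_abs, abs_mul c, abs_of_pos hc] at h2
  have h3 := Real.cosh_pos (c * τ)
  rw [abs_mul c, abs_of_pos hc] at h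
  gcongr
  linarith

/-- Half of the exponent is spent on absorbing the linear factor. -/
theorem mul_exp_neg_mul_le {c r : ℝ} (hc : 0 < c) :
    r * Real.exp (-(c * r)) ≤ 2 / c * Real.exp (-(c / 2 * r)) := by
  have h1 : -(c * r) = -(c / 2 * r) + -(c / 2 * r) := by ring
  have h2 : c / 2 * r ≤ Real.exp (c / 2 * r) := by
    linarith [Real.add_one_le_exp (c / 2 * r)]
  rw [h1, Real.exp_add, ← mul_assoc]
  refine mul_le_mul_of_nonneg_right ?_ (Real.exp_pos _).le
  rw [Real.exp_neg, ← div_eq_mul_inv, div_le_iff₀ (Real.exp_pos _)]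
  calc r = 2 / c * (c / 2 * r) := by field_simp
    _ ≤ _ := by gcongr

/-- Exponential decay of the Macdonald function in the index. -/
theorem abs_macdonaldK_le_mul_exp {x δ : ℝ} (hx : 0 < x) (hδ : |δ| < Real.pi / 2) (τ : ℝ) :
    |macdonaldK τ x| ≤ macdonaldK 0 (x * Real.cos δ) * Real.exp (-(δ * |τ|)) := by
  have h := exp_mul_abs_mul_abs_macdonaldK_le hx hδ τ
  have h2 := Real.exp_pos (δ * |τ|)
  rw [Real.exp_neg]
  field_simp
  linarith

theorem integrable_mul_exp_mul_macdonaldK {x δ : ℝ} (hx : 0 < x) (hδ : |δ| < Real.pi / 2) :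
    Integrable fun τ : ℝ => τ * Real.exp (δ * τ) * macdonaldK τ x := by
  -- Decay at a rate `γ` above `|δ|` leaves the margin `γ - |δ|` to absorb the factor `τ`.
  obtain ⟨γ, hγ1, hγ2⟩ := exists_between hδ
  have hγ0 : 0 < γ := (abs_nonneg δ).trans_lt hγ1
  have hγ : |γ| < Real.pi / 2 := by rwa [abs_of_pos hγ0]
  have hc : 0 < γ - |δ| := sub_pos.2 hγ1
  have hK : 0 < macdonaldK 0 (x * Real.cos γ) :=
    macdonaldK_zero_pos (mul_pos hx (Real.cos_pos_of_mem_Ioo (abs_lt.1 hγ)))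
  refine ((integrable_exp_neg_mul_abs (half_pos hc)).const_mul
    (macdonaldK 0 (x * Real.cos γ) * (2 / (γ - |δ|)))).mono' ?_ (ae_of_all _ fun τ => ?_)
  · exact ((Measurable.aestronglyMeasurable (by fun_prop)).mul
      (measurable_macdonaldK_index x).aestronglyMeasurable)
  · rw [Real.norm_eq_abs, abs_mul, abs_mul, Real.abs_exp]
    have h1 : δ * τ ≤ |δ| * |τ| := by rw [← abs_mul]; exact le_abs_self _
    calc |τ| * Real.exp (δ * τ) * |macdonaldK τ x|
        ≤ |τ| * Real.exp (|δ| * |τ|) *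
          (macdonaldK 0 (x * Real.cos γ) * Real.exp (-(γ * |τ|))) := by
          gcongr
          exact abs_macdonaldK_le_mul_exp hx hγ τ
      _ = macdonaldK 0 (x * Real.cos γ) * (|τ| * Real.exp (-((γ - |δ|) * |τ|))) := by
          rw [show -((γ - |δ|) * |τ|) = |δ| * |τ| + -(γ * |τ|) by ring, Real.exp_add]
          ring
      _ ≤ macdonaldK 0 (x * Real.cos γ) *
          (2 / (γ - |δ|) * Real.exp (-((γ - |δ|) / 2 * |τ|))) := by
          exact mul_le_mul_of_nonneg_left (mul_exp_neg_mul_le hc) hK.le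
      _ = _ := by ring

/-- Integration by parts: `(iτ - x sinh z)` times `expCosh` is a total derivative along the line.
This is where the factor `τ` comes from. -/
theorem integral_sinh_mul_expCosh {x δ : ℝ} (hx : 0 < x) (hδ : |δ| < Real.pi / 2) (τ : ℝ) :
    ∫ u : ℝ, x * Complex.sinh (u + δ * Complex.I) *
      expCosh (x / 2) (x / 2) τ (u + δ * Complex.I) = Complex.I * τ * (2 * macdonaldK τ x) := by
  obtain ⟨h1, h2⟩ := half_mul_exp_mul_I_re_pos hx hδ
  have h3 := integral_sub ((integrable_expCosh τ h1 h2).const_mul (Complex.I * τ))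
    (integrable_deriv_expCosh τ h1 h2)
  rw [integral_deriv_expCosh τ h1 h2, integral_const_mul, integral_exp_cosh_shift hx hδ,
    sub_zero] at h3
  rw [← h3]
  refine integral_congr_ae (ae_of_all _ fun u => ?_)
  simp only [Complex.sinh]
  ring

theorem integrable_sinh_mul_expCosh {x δ : ℝ} (hx : 0 < x) (hδ : |δ| < Real.pi / 2) (τ : ℝ) :
    Integrable fun u : ℝ => x * Complex.sinh (u + δ * Complex.I) *
      expCosh (x / 2) (x / 2) τ (u + δ * Complex.I) := by
  obtain ⟨h1, h2⟩ := half_mul_exp_mul_I_re_pos hx hδ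
  refine (((integrable_expCosh τ h1 h2).const_mul (Complex.I * τ)).sub
    (integrable_deriv_expCosh τ h1 h2)).congr (ae_of_all _ fun u => ?_)
  simp only [Complex.sinh, Pi.sub_apply]
  ring

theorem integral_mul_exp_mul_macdonaldK_mul_exp {x δ : ℝ} (hx : 0 < x) (hδ : |δ| < Real.pi / 2)
    (u : ℝ) :
    ∫ τ : ℝ, ((τ * Real.exp (δ * τ) * macdonaldK τ x : ℝ) : ℂ) * Complex.exp (Complex.I * τ * u) =
      Complex.I * Real.pi * (x * Complex.sinh (u - δ * Complex.I) *
        Complex.exp (-(x * Complex.cosh (u - δ * Complex.I)))) := by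
  have hH : ∀ τ : ℝ, ∫ u : ℝ, (x * Complex.sinh (u + δ * Complex.I) *
      expCosh (x / 2) (x / 2) 0 (u + δ * Complex.I)) * Complex.exp (Complex.I * τ * u) =
      2 * Complex.I * ((τ * Real.exp (δ * τ) * macdonaldK τ x : ℝ) : ℂ) := fun τ => by
    have h1 : ∀ u : ℝ, (x * Complex.sinh (u + δ * Complex.I) *
        expCosh (x / 2) (x / 2) 0 (u + δ * Complex.I)) * Complex.exp (Complex.I * τ * u) =
        Complex.exp (δ * τ) * (x * Complex.sinh (u + δ * Complex.I) *
          expCosh (x / 2) (x / 2) τ (u + δ * Complex.I)) := fun u => by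
      have h2 : Complex.exp (Complex.I * τ * u) = Complex.exp (δ * τ) *
          Complex.exp (Complex.I * τ * (u + δ * Complex.I)) := by
        rw [← Complex.exp_add]
        congr 1
        linear_combination (-δ * τ : ℂ) * Complex.I_sq
      rw [← exp_mul_cosh_eq_expCosh, ← exp_mul_cosh_eq_expCosh, h2]
      simp only [Complex.ofReal_zero, mul_zero, zero_mul, Complex.exp_zero]
      ring
    simp only [h1]
    rw [integral_const_mul, integral_sinh_mul_expCosh hx hδ]
    push_cast
    ring
  have hcont : Continuous fun u : ℝ => x * Complex.sinh (u + δ * Complex.I) *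
      expCosh (x / 2) (x / 2) 0 (u + δ * Complex.I) := by
    have : Continuous fun u : ℝ => expCosh (x / 2) (x / 2) 0 (u + δ * Complex.I) :=
      (continuous_expCosh _ _ _).comp (by fun_prop)
    fun_prop
  -- Evaluating at `-u` gives the exponential `e^{iτu}` and turns `u + iδ` into `-(u - iδ)`.
  have h3 := integral_mul_exp_neg_of_integral_mul_exp (v := -u)
    (integrable_sinh_mul_expCosh hx hδ 0) hcont.continuousAt hH
    ((integrable_mul_exp_mul_macdonaldK hx hδ).ofReal.const_mul _)
  have h4 : ∀ τ : ℝ, 2 * Complex.I * ((τ * Real.exp (δ * τ) * macdonaldK τ x : ℝ) : ℂ) *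
      Complex.exp (-(Complex.I * τ * ((-u : ℝ) : ℂ))) = 2 * Complex.I *
      (((τ * Real.exp (δ * τ) * macdonaldK τ x : ℝ) : ℂ) * Complex.exp (Complex.I * τ * u)) :=
    fun τ => by
      push_cast
      rw [mul_neg, neg_neg]
      ring
  simp only [h4] at h3
  rw [integral_const_mul, ← exp_mul_cosh_eq_expCosh] at h3
  have h5 : ((-u : ℝ) : ℂ) + δ * Complex.I = -(u - δ * Complex.I) := by push_cast; ring
  rw [h5, Complex.sinh_neg, Complex.cosh_neg] at h3
  simp only [Complex.ofReal_zero, mul_zero, zero_mul, Complex.exp_zero, mul_one] at h3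
  linear_combination (-Complex.I / 2) * h3 + (∫ τ : ℝ,
    ((τ * Real.exp (δ * τ) * macdonaldK τ x : ℝ) : ℂ) * Complex.exp (Complex.I * τ * u)) *
    Complex.I_sq

/-! ### `coshLaplace` on a strip: decay up to the edge, and its Fourier integral. -/

/-- The inner integral `∫ exp (-((a + cosh z) eˢ + b e⁻ˢ)) ds`, a function of `z` on a strip. -/
noncomputable def coshLaplace (a b : ℝ) (z : ℂ) : ℂ :=
  ∫ s : ℝ, expCosh (a + Complex.cosh z) b 0 s

theorem re_cosh_mul_exp_mul_I (u δ ψ : ℝ) :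
    (Complex.cosh (u + δ * Complex.I) * Complex.exp (ψ * Complex.I)).re =
      Real.cosh u * Real.cos δ * Real.cos ψ - Real.sinh u * Real.sin δ * Real.sin ψ := by
  rw [Complex.cosh_add, Complex.cosh_mul_I, Complex.sinh_mul_I, ← Complex.ofReal_cosh,
    ← Complex.ofReal_sinh, ← Complex.ofReal_cos, ← Complex.ofReal_sin, Complex.exp_mul_I,
    ← Complex.ofReal_cos, ← Complex.ofReal_sin]
  simp
  rfl

theorem re_ofReal_mul_exp_neg_mul_I (b ψ : ℝ) :
    ((b : ℂ) * Complex.exp (-(ψ * Complex.I))).re = b * Real.cos ψ := by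
  rw [Complex.re_ofReal_mul, ← neg_mul, ← Complex.ofReal_neg, Complex.exp_ofReal_mul_I_re,
    Real.cos_neg]

theorem re_add_cosh_mul_exp_mul_I (a u δ ψ : ℝ) :
    ((a + Complex.cosh (u + δ * Complex.I)) * Complex.exp (ψ * Complex.I)).re =
      a * Real.cos ψ + Real.cosh u * Real.cos δ * Real.cos ψ
        - Real.sinh u * Real.sin δ * Real.sin ψ := by
  rw [add_mul, Complex.add_re, re_cosh_mul_exp_mul_I, Complex.re_ofReal_mul,
    Complex.exp_ofReal_mul_I_re]
  ring

theorem norm_expCosh_add_cosh (a b s u δ : ℝ) :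
    ‖expCosh (a + Complex.cosh (u + δ * Complex.I)) b 0 s‖ =
      Real.exp (-((a + Real.cosh u * Real.cos δ) * Real.exp s + b * Real.exp (-s))) := by
  have h := norm_expCosh (a + Complex.cosh (u + δ * Complex.I)) b 0 s 0
  have h1 := re_add_cosh_mul_exp_mul_I a u δ 0
  have h2 := re_ofReal_mul_exp_neg_mul_I b 0
  rw [h1, h2] at h
  simpa using h

theorem integrable_exp_neg_add {a b : ℝ} (ha : 0 < a) (hb : 0 < b) :
    Integrable fun s : ℝ => Real.exp (-(a * Real.exp s + b * Real.exp (-s))) := by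
  have h := (integrable_expCosh (A := a) (B := b) (ψ := 0) 0 (by simpa) (by simpa)).norm
  refine h.congr (ae_of_all _ fun s => ?_)
  simp only
  rw [norm_expCosh]
  simp

theorem integrable_exp_mul_abs_mul_exp_neg_add (k : ℝ) {a b : ℝ} (ha : 0 < a) (hb : 0 < b) :
    Integrable fun s : ℝ =>
      Real.exp (k * |s|) * Real.exp (-(a * Real.exp s + b * Real.exp (-s))) := by
  refine (integrable_exp_mul_abs_sub_mul_cosh k (mul_pos two_pos (lt_min ha hb))).mono'
    (by fun_prop) (ae_of_all _ fun s => ?_)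
  rw [← Real.exp_add, Real.norm_eq_abs, Real.abs_exp, Real.exp_le_exp, Real.cosh_eq]
  have h1 := mul_le_mul_of_nonneg_right (min_le_left a b) (Real.exp_pos s).le
  have h2 := mul_le_mul_of_nonneg_right (min_le_right a b) (Real.exp_pos (-s)).le
  linarith

/-- The real part `cosh u cos δ` of `cosh(u + iδ)` is nonnegative and can be dropped, leaving a
bound independent of `δ` and `u`. -/
theorem norm_expCosh_add_cosh_le {a b s u δ : ℝ} (hδ : |δ| ≤ Real.pi / 2) :
    ‖expCosh (a + Complex.cosh (u + δ * Complex.I)) b 0 s‖ ≤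
      Real.exp (-(a * Real.exp s + b * Real.exp (-s))) := by
  rw [norm_expCosh_add_cosh, Real.exp_le_exp]
  have h1 := Real.cos_nonneg_of_mem_Icc (abs_le.1 hδ)
  have h2 : 0 ≤ Real.cosh u * Real.cos δ * Real.exp s := by
    have := Real.cosh_pos u
    positivity
  linarith

theorem tendsto_coshLaplace {a b : ℝ} (ha : 0 < a) (hb : 0 < b) (u : ℝ) :
    Filter.Tendsto (fun δ : ℝ => coshLaplace a b (u + δ * Complex.I))
      (nhdsWithin (Real.pi / 2) (Ioo (Real.pi / 4) (Real.pi / 2)))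
      (nhds (coshLaplace a b (u + (Real.pi / 2 : ℝ) * Complex.I))) := by
  refine tendsto_integral_filter_of_dominated_convergence _ ?_ ?_ (integrable_exp_neg_add ha hb) ?_
  · exact Filter.Eventually.of_forall fun δ =>
      ((continuous_expCosh _ _ _).comp Complex.continuous_ofReal).aestronglyMeasurable
  · filter_upwards [self_mem_nhdsWithin] with δ hδ
    refine ae_of_all _ fun s => norm_expCosh_add_cosh_le ?_
    rw [abs_of_pos (by linarith [hδ.1, Real.pi_pos])]
    exact hδ.2.le
  · refine ae_of_all _ fun s => ?_
    have : Continuous fun δ : ℝ => expCosh (a + Complex.cosh (u + δ * Complex.I)) b 0 s := by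
      unfold expCosh
      fun_prop
    exact (this.tendsto _).mono_left nhdsWithin_le_nhds

/-- Exchanges exponential decay in `r e^s` for quadratic decay in `r`, at the cost of `e^{2|s|}`.
The constant 9 comes from `1 ≤ e^v` and `4v² ≤ 8e^v`. -/
theorem one_add_sq_mul_exp_neg_le {r : ℝ} (hr : 0 ≤ r) (s : ℝ) :
    (1 + r ^ 2) * Real.exp (-(r / 2 * Real.exp s)) ≤ 9 * Real.exp (2 * |s|) := by
  set v := r / 2 * Real.exp s with hv
  have hv0 : 0 ≤ v := by positivity
  have h1 : 1 + v + v ^ 2 / 2 ≤ Real.exp v := Real.quadratic_le_exp_of_nonneg hv0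
  have h2 : r ^ 2 = 4 * v ^ 2 * Real.exp (-(2 * s)) := by
    rw [hv, show -(2 * s) = -s + -s by ring, Real.exp_add, Real.exp_neg]
    field_simp
    ring
  have h3 : Real.exp (-(2 * s)) ≤ Real.exp (2 * |s|) :=
    Real.exp_le_exp.2 (by linarith [neg_le_abs s])
  have h4 : 1 ≤ Real.exp (2 * |s|) := Real.one_le_exp (by positivity)
  rw [Real.exp_neg v, ← div_eq_mul_inv, div_le_iff₀ (Real.exp_pos v), h2]
  calc 1 + 4 * v ^ 2 * Real.exp (-(2 * s))
      ≤ Real.exp (2 * |s|) + 4 * v ^ 2 * Real.exp (2 * |s|) := by gcongr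
    _ = Real.exp (2 * |s|) * (1 + 4 * v ^ 2) := by ring
    _ ≤ Real.exp (2 * |s|) * (9 * Real.exp v) := by gcongr; nlinarith
    _ = _ := by ring

/-- As `δ → π/2` the real part of `cosh(u + iδ)` degenerates, but its imaginary part `sinh u sin δ`
stays large. Shifting `s` by `∓iπ/4`, with sign opposite to that of `u`, converts it into positive
real part without losing positivity on the way. The restriction `δ ≥ π/4` keeps `sin δ` at least
`√2/2`. -/
theorem exists_rotation {a : ℝ} (ha : 0 < a) {δ : ℝ} (h1 : Real.pi / 4 ≤ δ)
    (h2 : δ ≤ Real.pi / 2) (u : ℝ) : ∃ ψ : ℝ,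
    (∀ φ ∈ uIcc 0 ψ, 0 < Real.cos φ ∧
      0 < ((a + Complex.cosh (u + δ * Complex.I)) * Complex.exp (φ * Complex.I)).re) ∧
    Real.cos ψ = √2 / 2 ∧ a * (√2 / 2) + |Real.sinh u| / 2 ≤
      ((a + Complex.cosh (u + δ * Complex.I)) * Complex.exp (ψ * Complex.I)).re := by
  have hpi := Real.pi_pos
  have hcosδ : 0 ≤ Real.cos δ := Real.cos_nonneg_of_mem_Icc ⟨by linarith, h2⟩
  have hsinδ : √2 / 2 ≤ Real.sin δ := by
    rw [← Real.sin_pi_div_four]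
    exact Real.sin_le_sin_of_le_of_le_pi_div_two (by linarith) h2 h1
  have hcosh := Real.cosh_pos u
  have hs2 : 0 < √2 := by positivity
  have key : ∀ φ : ℝ, |φ| ≤ Real.pi / 4 → Real.sinh u * Real.sin φ ≤ 0 →
      0 < Real.cos φ ∧
      0 < ((a + Complex.cosh (u + δ * Complex.I)) * Complex.exp (φ * Complex.I)).re := by
    intro φ hφ hs
    have hφ' := abs_le.1 hφ
    have hc : 0 < Real.cos φ := Real.cos_pos_of_mem_Ioo ⟨by linarith, by linarith⟩
    refine ⟨hc, ?_⟩
    rw [re_add_cosh_mul_exp_mul_I]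
    have h3 : 0 ≤ Real.cosh u * Real.cos δ * Real.cos φ := by positivity
    have h4 : Real.sinh u * Real.sin φ * Real.sin δ ≤ 0 :=
      mul_nonpos_of_nonpos_of_nonneg hs (by linarith)
    have h5 : 0 < a * Real.cos φ := by positivity
    linarith
  have hend : ∀ ψ : ℝ, Real.cos ψ = √2 / 2 → Real.sinh u * Real.sin ψ = -(|Real.sinh u| * (√2 / 2)) →
      a * (√2 / 2) + |Real.sinh u| / 2 ≤
      ((a + Complex.cosh (u + δ * Complex.I)) * Complex.exp (ψ * Complex.I)).re := by
    intro ψ hc hs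
    rw [re_add_cosh_mul_exp_mul_I, mul_right_comm (Real.sinh u), hs, hc]
    have h3 : 0 ≤ Real.cosh u * Real.cos δ * (√2 / 2) := by positivity
    have h4 : |Real.sinh u| * (√2 / 2) * (√2 / 2) ≤ |Real.sinh u| * (√2 / 2) * Real.sin δ := by
      gcongr
    have h5 : |Real.sinh u| * (√2 / 2) * (√2 / 2) = |Real.sinh u| / 2 := by
      have := Real.mul_self_sqrt (zero_le_two : (0 : ℝ) ≤ 2)
      linear_combination |Real.sinh u| / 4 * this
    linarith
  rcases le_total 0 u with hu | hu
  · have hsu := Real.sinh_nonneg_iff.2 hu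
    refine ⟨-(Real.pi / 4), fun φ hφ => ?_, by rw [Real.cos_neg, Real.cos_pi_div_four],
      hend _ (by rw [Real.cos_neg, Real.cos_pi_div_four]) ?_⟩
    · rw [uIcc_of_ge (by linarith)] at hφ
      exact key φ (abs_le.2 ⟨hφ.1, by linarith [hφ.2]⟩) (mul_nonpos_of_nonneg_of_nonpos hsu
        (Real.sin_nonpos_of_nonpos_of_neg_pi_le hφ.2 (by linarith [hφ.1])))
    · rw [Real.sin_neg, Real.sin_pi_div_four, abs_of_nonneg hsu]
      ring
  · have hsu := Real.sinh_nonpos_iff.2 hu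
    refine ⟨Real.pi / 4, fun φ hφ => ?_, Real.cos_pi_div_four, hend _ Real.cos_pi_div_four ?_⟩
    · rw [uIcc_of_le (by linarith)] at hφ
      exact key φ (abs_le.2 ⟨by linarith [hφ.1], hφ.2⟩) (mul_nonpos_of_nonpos_of_nonneg hsu
        (Real.sin_nonneg_of_nonneg_of_le_pi hφ.1 (by linarith [hφ.2])))
    · rw [Real.sin_pi_div_four, abs_of_nonpos hsu]
      ring

/-- The decay of `coshLaplace` obtained by rotating the ray of integration. -/
theorem exists_norm_coshLaplace_le {a b : ℝ} (ha : 0 < a) (hb : 0 < b) :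
    ∃ C : ℝ, 0 ≤ C ∧ ∀ δ, Real.pi / 4 ≤ δ → δ ≤ Real.pi / 2 → ∀ u : ℝ,
      ‖coshLaplace a b (u + δ * Complex.I)‖ ≤ C * (Real.cosh u ^ 2)⁻¹ := by
  set c : ℝ := √2 / 2
  have hc : 0 < c := by positivity
  have hI := (integrable_exp_mul_abs_mul_exp_neg_add 2 (mul_pos ha hc) (mul_pos hb hc)).const_mul 9
  refine ⟨∫ s : ℝ, 9 * (Real.exp (2 * |s|) *
      Real.exp (-(a * c * Real.exp s + b * c * Real.exp (-s)))),
    integral_nonneg fun s => by positivity, fun δ h1 h2 u => ?_⟩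
  obtain ⟨ψ, hψ, hcos, hre⟩ := exists_rotation ha h1 h2 u
  change Real.cos ψ = c at hcos
  change a * c + |Real.sinh u| / 2 ≤ _ at hre
  have hcosh : 0 < Real.cosh u ^ 2 := pow_pos (Real.cosh_pos u) 2
  rw [coshLaplace, ← integral_expCosh_shift 0 (ψ := ψ) fun φ hφ =>
    ⟨(hψ φ hφ).2, by rw [re_ofReal_mul_exp_neg_mul_I]; exact mul_pos hb (hψ φ hφ).1⟩,
    ← div_eq_mul_inv, ← integral_div]
  refine norm_integral_le_of_norm_le (hI.div_const _) (ae_of_all _ fun s => ?_)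
  rw [norm_expCosh, re_ofReal_mul_exp_neg_mul_I, hcos, le_div_iff₀ hcosh, zero_mul, sub_zero,
    Real.cosh_sq, add_comm _ (1 : ℝ), ← sq_abs]
  have h3 := one_add_sq_mul_exp_neg_le (abs_nonneg (Real.sinh u)) s
  have h4 := mul_le_mul_of_nonneg_right hre (Real.exp_pos s).le
  calc _ ≤ Real.exp (-(|Real.sinh u| / 2 * Real.exp s) +
        -(a * c * Real.exp s + b * c * Real.exp (-s))) * (1 + |Real.sinh u| ^ 2) := by
        gcongr
        linarith
    _ = ((1 + |Real.sinh u| ^ 2) * Real.exp (-(|Real.sinh u| / 2 * Real.exp s))) *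
        Real.exp (-(a * c * Real.exp s + b * c * Real.exp (-s))) := by
        rw [Real.exp_add]; ring
    _ ≤ 9 * Real.exp (2 * |s|) *
        Real.exp (-(a * c * Real.exp s + b * c * Real.exp (-s))) := by gcongr
    _ = _ := by ring

theorem integrable_mul_exp_add_cosh {a b δ : ℝ} (ha : 0 < a) (hb : 0 < b)
    (hδ : |δ| < Real.pi / 2) (τ : ℝ) :
    Integrable (fun z : ℝ × ℝ => expCosh (a + Complex.cosh (z.1 + δ * Complex.I)) b 0 z.2 *
      Complex.exp (Complex.I * τ * (z.1 + δ * Complex.I))) (volume.prod volume) := by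
  have hc : 0 < Real.cos δ := Real.cos_pos_of_mem_Ioo (abs_lt.1 hδ)
  have hI := (integrable_inv_cosh.const_mul ((Real.cos δ)⁻¹ * Real.exp (-(τ * δ)))).mul_prod
    (integrable_exp_mul_abs_mul_exp_neg_add 1 ha hb)
  refine hI.mono' ?_ (ae_of_all _ fun z => ?_)
  · unfold expCosh
    exact Continuous.aestronglyMeasurable (by fun_prop)
  · have hch := Real.cosh_pos z.1
    have h1 : ‖Complex.exp (Complex.I * τ * (z.1 + δ * Complex.I))‖ = Real.exp (-(τ * δ)) := by
      rw [Complex.norm_exp]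
      simp
    -- From `e^{-r} ≤ 1/r`. The constant blows up as `δ → π/2`, so this bound serves only at fixed
    -- `δ`.
    have h2 : Real.exp (-(Real.cosh z.1 * Real.cos δ * Real.exp z.2)) ≤
        (Real.cos δ)⁻¹ * (Real.cosh z.1)⁻¹ * Real.exp |z.2| := by
      have h3 : Real.cosh z.1 * Real.cos δ * Real.exp z.2 ≤
          Real.exp (Real.cosh z.1 * Real.cos δ * Real.exp z.2) := by
        linarith [Real.add_one_le_exp (Real.cosh z.1 * Real.cos δ * Real.exp z.2)]
      calc _ ≤ (Real.cosh z.1 * Real.cos δ * Real.exp z.2)⁻¹ := by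
            rw [Real.exp_neg]
            gcongr
        _ = (Real.cos δ)⁻¹ * (Real.cosh z.1)⁻¹ * Real.exp (-z.2) := by
            rw [Real.exp_neg, mul_inv, mul_inv]; ring
        _ ≤ _ := by gcongr; exact neg_le_abs _
    rw [norm_mul, norm_expCosh_add_cosh, h1]
    calc _ = Real.exp (-(Real.cosh z.1 * Real.cos δ * Real.exp z.2)) *
          Real.exp (-(a * Real.exp z.2 + b * Real.exp (-z.2))) * Real.exp (-(τ * δ)) := by
          rw [← Real.exp_add, ← Real.exp_add, ← Real.exp_add]
          ring_nf
      _ ≤ ((Real.cos δ)⁻¹ * (Real.cosh z.1)⁻¹ * Real.exp |z.2|) *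
          Real.exp (-(a * Real.exp z.2 + b * Real.exp (-z.2))) * Real.exp (-(τ * δ)) := by
          gcongr
      _ = _ := by rw [one_mul]; ring

theorem integrable_coshLaplace {a b δ : ℝ} (ha : 0 < a) (hb : 0 < b) (hδ : |δ| < Real.pi / 2) :
    Integrable fun u : ℝ => coshLaplace a b (u + δ * Complex.I) := by
  have h := (integrable_mul_exp_add_cosh ha hb hδ 0).integral_prod_left
  simpa [coshLaplace] using h

/-- The product of two Macdonald functions as a Fourier transform along a shifted line. -/
theorem integral_coshLaplace_mul_exp {y t δ : ℝ} (hy : 0 < y) (ht : 0 < t)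
    (hδ : |δ| < Real.pi / 2) (τ : ℝ) :
    ∫ u : ℝ, coshLaplace ((y ^ 2 + t ^ 2) / (2 * y * t)) (y * t / 2) (u + δ * Complex.I) *
      Complex.exp (Complex.I * τ * u) =
    Real.exp (δ * τ) * (4 * (macdonaldK τ y * macdonaldK τ t)) := by
  set a := (y ^ 2 + t ^ 2) / (2 * y * t) with hadef
  set b := y * t / 2 with hbdef
  have ha : 0 < a := by positivity
  have hb : 0 < b := by positivity
  have h1 : ∫ u : ℝ, ∫ s : ℝ, expCosh (a + Complex.cosh (u + δ * Complex.I)) b 0 s *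
      Complex.exp (Complex.I * τ * (u + δ * Complex.I)) =
      4 * (macdonaldK τ y * macdonaldK τ t) := by
    -- For fixed `s` the `u`-integral is a Macdonald integral on a shifted line, and the remaining
    -- `s`-integral is the product formula.
    rw [integral_integral_swap (integrable_mul_exp_add_cosh ha hb hδ τ)]
    have h2 : ∀ s : ℝ, ∫ u : ℝ, expCosh (a + Complex.cosh (u + δ * Complex.I)) b 0 s *
        Complex.exp (Complex.I * τ * (u + δ * Complex.I)) =
        2 * ((klKernel (Real.exp s) y t * macdonaldK τ (Real.exp s) : ℝ) : ℂ) := fun s => by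
      have h3 : ∀ u : ℝ, expCosh (a + Complex.cosh (u + δ * Complex.I)) b 0 s *
          Complex.exp (Complex.I * τ * (u + δ * Complex.I)) = (klKernel (Real.exp s) y t : ℂ) *
          expCosh ((Real.exp s : ℝ) / 2) ((Real.exp s : ℝ) / 2) τ (u + δ * Complex.I) := fun u => by
        rw [klKernel_exp, ← exp_mul_cosh_eq_expCosh, Complex.ofReal_exp, expCosh,
          ← Complex.exp_add, ← Complex.exp_add, ← Complex.exp_add, ← hadef, ← hbdef]
        push_cast
        ring_nf
      simp only [h3]
      rw [integral_const_mul, integral_exp_cosh_shift (Real.exp_pos s) hδ]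
      push_cast
      ring
    simp only [h2]
    rw [integral_const_mul, integral_complex_ofReal,
      integral_klKernel_exp_mul_macdonaldK hy ht]
    push_cast
    ring
  rw [← h1, ← integral_const_mul]
  refine integral_congr_ae (ae_of_all _ fun u => ?_)
  simp only
  rw [integral_mul_const, coshLaplace, mul_left_comm, Complex.ofReal_exp, ← Complex.exp_add]
  congr 2
  push_cast
  linear_combination (-δ * τ : ℂ) * Complex.I_sq

/-! ### The limit `δ → π/2` and the index integral of three Macdonald functions. -/

theorem abs_mul_exp_mul_exp_pow_three_le {δ : ℝ} (hδ : Real.pi / 3 < δ) (τ : ℝ) :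
    |τ| * Real.exp (Real.pi * |τ|) * Real.exp (-(δ * |τ|)) ^ 3 ≤
      2 / (3 * δ - Real.pi) * Real.exp (-((3 * δ - Real.pi) / 2 * |τ|)) := by
  refine le_trans (le_of_eq ?_) (mul_exp_neg_mul_le (by linarith))
  rw [← Real.exp_nat_mul, mul_assoc, ← Real.exp_add]
  congr 2
  push_cast
  ring

theorem integrable_abs_mul_exp_mul_exp_pow_three {δ : ℝ} (hδ : Real.pi / 3 < δ) :
    Integrable fun τ : ℝ => |τ| * Real.exp (Real.pi * |τ|) * Real.exp (-(δ * |τ|)) ^ 3 := by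
  refine ((integrable_exp_neg_mul_abs (c := (3 * δ - Real.pi) / 2) (by linarith)).const_mul
    (2 / (3 * δ - Real.pi))).mono' (by fun_prop) (ae_of_all _ fun τ => ?_)
  rw [Real.norm_of_nonneg (by positivity)]
  exact abs_mul_exp_mul_exp_pow_three_le hδ τ

theorem norm_sinh_sub_mul_I_le {u δ : ℝ} : ‖Complex.sinh (u - δ * Complex.I)‖ ≤ Real.cosh u := by
  rw [Complex.sinh_sub, Complex.cosh_mul_I, Complex.sinh_mul_I, ← Complex.ofReal_cosh,
    ← Complex.ofReal_sinh, ← Complex.ofReal_cos, ← Complex.ofReal_sin, ← mul_assoc,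
    ← Complex.ofReal_mul, ← Complex.ofReal_mul]
  refine (le_abs_self _).trans (abs_le_of_sq_le_sq ?_ (Real.cosh_pos u).le)
  rw [Complex.sq_norm, sub_eq_add_neg, ← neg_mul, ← Complex.ofReal_neg, Complex.normSq_add_mul_I,
    neg_sq, mul_pow, mul_pow, Real.sinh_sq, Real.sin_sq]
  linarith [sq_nonneg (Real.cos δ)]

theorem norm_exp_neg_mul_cosh_sub_mul_I_le {x u δ : ℝ} (hx : 0 < x) (hδ : |δ| ≤ Real.pi / 2) :
    ‖Complex.exp (-(x * Complex.cosh (u - δ * Complex.I)))‖ ≤ 1 := by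
  have h1 := re_cosh_mul_exp_mul_I u (-δ) 0
  have h2 : ((u : ℂ) + ((-δ : ℝ) : ℂ) * Complex.I) = u - δ * Complex.I := by push_cast; ring
  have h3 := Real.cos_nonneg_of_mem_Icc (abs_le.1 hδ)
  have h4 := Real.cosh_pos u
  rw [h2] at h1
  simp only [Complex.ofReal_zero, zero_mul, Complex.exp_zero, mul_one, Real.cos_neg, Real.cos_zero,
    Real.sin_zero, mul_zero, sub_zero] at h1
  rw [Complex.norm_exp, Complex.neg_re, Complex.re_ofReal_mul, h1, Real.exp_le_one_iff]
  have : 0 ≤ x * (Real.cosh u * Real.cos δ) := by positivity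
  linarith

/-- A Parseval identity: the product of two Macdonald functions is expanded as a Fourier integral,
and after Fubini the `τ`-integral is the transform already computed. -/
theorem integral_macdonaldK_triple_shift {x y t δ : ℝ} (hx : 0 < x) (hy : 0 < y) (ht : 0 < t)
    (hδ : |δ| < Real.pi / 2) :
    ∫ τ : ℝ, ((τ * Real.exp (δ * τ) * macdonaldK τ x : ℝ) : ℂ) *
      (Real.exp (δ * τ) * (4 * (macdonaldK τ y * macdonaldK τ t))) =
    ∫ u : ℝ, coshLaplace ((y ^ 2 + t ^ 2) / (2 * y * t)) (y * t / 2) (u + δ * Complex.I) *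
      (Complex.I * Real.pi * (x * Complex.sinh (u - δ * Complex.I) *
        Complex.exp (-(x * Complex.cosh (u - δ * Complex.I))))) := by
  have hN := integrable_coshLaplace (a := (y ^ 2 + t ^ 2) / (2 * y * t)) (b := y * t / 2)
    (by positivity) (by positivity) hδ
  have hK := (integrable_mul_exp_mul_macdonaldK hx hδ).ofReal (𝕜 := ℂ)
  have hI : Integrable (fun z : ℝ × ℝ => ((z.1 * Real.exp (δ * z.1) * macdonaldK z.1 x : ℝ) : ℂ) *
      coshLaplace ((y ^ 2 + t ^ 2) / (2 * y * t)) (y * t / 2) (z.2 + δ * Complex.I) *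
      Complex.exp (Complex.I * z.1 * z.2)) (volume.prod volume) := by
    refine (hK.mul_prod hN).mono ?_ (ae_of_all _ fun z => ?_)
    · exact (hK.mul_prod hN).1.mul (Continuous.aestronglyMeasurable (by fun_prop))
    · rw [norm_mul, Complex.norm_exp (Complex.I * z.1 * z.2)]
      simp
  simp only [← integral_coshLaplace_mul_exp hy ht hδ, ← integral_const_mul]
  have h1 := integral_integral_swap (f := fun τ u : ℝ =>
    ((τ * Real.exp (δ * τ) * macdonaldK τ x : ℝ) : ℂ) *
      coshLaplace ((y ^ 2 + t ^ 2) / (2 * y * t)) (y * t / 2) (u + δ * Complex.I) *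
      Complex.exp (Complex.I * τ * u)) hI
  simp only [mul_assoc] at h1 ⊢
  rw [h1]
  refine integral_congr_ae (ae_of_all _ fun u => ?_)
  simp only
  have h2 := integral_mul_exp_mul_macdonaldK_mul_exp hx hδ u
  simp only [mul_assoc] at h2
  rw [← h2, ← integral_const_mul]
  refine integral_congr_ae (ae_of_all _ fun τ => ?_)
  simp only
  ring

theorem integrable_mul_exp_mul_triple {x y t : ℝ} (hx : 0 < x) (hy : 0 < y) (ht : 0 < t) :
    ∃ g : ℝ → ℝ, Integrable g ∧ ∀ τ, |τ| * Real.exp (Real.pi * |τ|) *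
      (4 * (|macdonaldK τ x| * |macdonaldK τ y| * |macdonaldK τ t|)) ≤ g τ := by
  have hpi := Real.pi_pos
  -- Any angle between `π/3` and `π/2` would serve: above `π/3` for the decay of the triple product,
  -- below `π/2` for the shift.
  have hδ : |2 * Real.pi / 5| < Real.pi / 2 := by rw [abs_of_pos (by positivity)]; linarith
  refine ⟨_, (integrable_abs_mul_exp_mul_exp_pow_three (δ := 2 * Real.pi / 5)
    (by linarith)).const_mul (4 * (macdonaldK 0 (x * Real.cos (2 * Real.pi / 5)) *
      macdonaldK 0 (y * Real.cos (2 * Real.pi / 5)) *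
      macdonaldK 0 (t * Real.cos (2 * Real.pi / 5)))), fun τ => ?_⟩
  have hc : 0 < Real.cos (2 * Real.pi / 5) := Real.cos_pos_of_mem_Ioo (abs_lt.1 hδ)
  have h1 := abs_macdonaldK_le_mul_exp hx hδ τ
  have h2 := abs_macdonaldK_le_mul_exp hy hδ τ
  have h3 := abs_macdonaldK_le_mul_exp ht hδ τ
  have k1 := (macdonaldK_zero_pos (mul_pos hx hc)).le
  have k2 := (macdonaldK_zero_pos (mul_pos hy hc)).le
  calc _ ≤ |τ| * Real.exp (Real.pi * |τ|) *
      (4 * ((macdonaldK 0 (x * Real.cos (2 * Real.pi / 5)) *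
        Real.exp (-(2 * Real.pi / 5 * |τ|))) *
        (macdonaldK 0 (y * Real.cos (2 * Real.pi / 5)) * Real.exp (-(2 * Real.pi / 5 * |τ|))) *
        (macdonaldK 0 (t * Real.cos (2 * Real.pi / 5)) *
          Real.exp (-(2 * Real.pi / 5 * |τ|))))) := by gcongr
    _ = _ := by ring

theorem tendsto_integral_macdonaldK_triple {x y t : ℝ} (hx : 0 < x) (hy : 0 < y) (ht : 0 < t) :
    Filter.Tendsto (fun δ : ℝ => ∫ τ : ℝ, ((τ * Real.exp (δ * τ) * macdonaldK τ x : ℝ) : ℂ) *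
      (Real.exp (δ * τ) * (4 * (macdonaldK τ y * macdonaldK τ t))))
      (nhdsWithin (Real.pi / 2) (Ioo (Real.pi / 4) (Real.pi / 2)))
      (nhds (∫ τ : ℝ, ((τ * Real.exp (Real.pi / 2 * τ) * macdonaldK τ x : ℝ) : ℂ) *
      (Real.exp (Real.pi / 2 * τ) * (4 * (macdonaldK τ y * macdonaldK τ t))))) := by
  obtain ⟨g, hg, hle⟩ := integrable_mul_exp_mul_triple hx hy ht
  refine tendsto_integral_filter_of_dominated_convergence g ?_ ?_ hg ?_
  · refine Filter.Eventually.of_forall fun δ => Measurable.aestronglyMeasurable ?_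
    have h1 := measurable_macdonaldK_index x
    have h2 := measurable_macdonaldK_index y
    have h3 := measurable_macdonaldK_index t
    fun_prop
  · filter_upwards [self_mem_nhdsWithin] with δ hδ
    refine ae_of_all _ fun τ => le_trans ?_ (hle τ)
    have hδ0 : 0 < δ := by linarith [hδ.1, Real.pi_pos]
    have h1 : Real.exp (δ * τ) * Real.exp (δ * τ) ≤ Real.exp (Real.pi * |τ|) := by
      rw [← Real.exp_add, Real.exp_le_exp]
      calc δ * τ + δ * τ = 2 * δ * τ := by ring
        _ ≤ 2 * δ * |τ| := by gcongr; exact le_abs_self τ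
        _ ≤ _ := by gcongr; linarith [hδ.2]
    simp only [norm_mul, Complex.norm_real, Real.norm_eq_abs, Real.abs_exp, Complex.norm_ofNat]
    calc _ = |τ| * (Real.exp (δ * τ) * Real.exp (δ * τ)) *
        (4 * (|macdonaldK τ x| * |macdonaldK τ y| * |macdonaldK τ t|)) := by ring
      _ ≤ _ := by gcongr
  · refine ae_of_all _ fun τ => ?_
    have : Continuous fun δ : ℝ => ((τ * Real.exp (δ * τ) * macdonaldK τ x : ℝ) : ℂ) *
      (Real.exp (δ * τ) * (4 * (macdonaldK τ y * macdonaldK τ t))) := by fun_prop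
    exact (this.tendsto _).mono_left nhdsWithin_le_nhds

theorem tendsto_integral_coshLaplace {a b x : ℝ} (ha : 0 < a) (hb : 0 < b) (hx : 0 < x) :
    Filter.Tendsto (fun δ : ℝ => ∫ u : ℝ, coshLaplace a b (u + δ * Complex.I) *
      (Complex.I * Real.pi * (x * Complex.sinh (u - δ * Complex.I) *
        Complex.exp (-(x * Complex.cosh (u - δ * Complex.I))))))
      (nhdsWithin (Real.pi / 2) (Ioo (Real.pi / 4) (Real.pi / 2)))
      (nhds (∫ u : ℝ, coshLaplace a b (u + (Real.pi / 2 : ℝ) * Complex.I) *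
      (Complex.I * Real.pi * (x * Complex.sinh (u - (Real.pi / 2 : ℝ) * Complex.I) *
        Complex.exp (-(x * Complex.cosh (u - (Real.pi / 2 : ℝ) * Complex.I))))))) := by
  -- Of the two powers of `1 / cosh u`, uniform in `δ`, one is spent on the factor `sinh(u - iδ)`;
  -- the other is integrable.
  obtain ⟨C, hC0, hC⟩ := exists_norm_coshLaplace_le ha hb
  have hpi := Real.pi_pos
  refine tendsto_integral_filter_of_dominated_convergence
    (fun u => C * (Real.pi * x) * (Real.cosh u)⁻¹) ?_ ?_ (integrable_inv_cosh.const_mul _) ?_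
  · filter_upwards [self_mem_nhdsWithin] with δ hδ
    have hδ' : |δ| < Real.pi / 2 := by
      rw [abs_of_pos (by linarith [hδ.1])]
      exact hδ.2
    exact (integrable_coshLaplace ha hb hδ').1.mul
      (Continuous.aestronglyMeasurable (by fun_prop))
  · filter_upwards [self_mem_nhdsWithin] with δ hδ
    refine ae_of_all _ fun u => ?_
    have h1 := hC δ hδ.1.le hδ.2.le u
    have h2 := norm_sinh_sub_mul_I_le (u := u) (δ := δ)
    have h3 := norm_exp_neg_mul_cosh_sub_mul_I_le (u := u) (δ := δ) hx
      (by rw [abs_of_pos (by linarith [hδ.1])]; exact hδ.2.le)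
    have h4 := Real.cosh_pos u
    simp only [norm_mul, Complex.norm_I, Complex.norm_real, Real.norm_eq_abs, abs_of_pos hpi,
      abs_of_pos hx, one_mul]
    calc _ ≤ C * (Real.cosh u ^ 2)⁻¹ * (Real.pi * (x * Real.cosh u * 1)) := by gcongr
      _ = _ := by field_simp
  · refine ae_of_all _ fun u => (tendsto_coshLaplace ha hb u).mul ?_
    have : Continuous fun δ : ℝ => Complex.I * Real.pi * (x * Complex.sinh (u - δ * Complex.I) *
        Complex.exp (-(x * Complex.cosh (u - δ * Complex.I)))) := by fun_prop
    exact (this.tendsto _).mono_left nhdsWithin_le_nhds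

theorem cosh_add_pi_div_two_mul_I (u : ℝ) :
    Complex.cosh (u + (Real.pi / 2 : ℝ) * Complex.I) = Complex.I * Real.sinh u := by
  rw [Complex.cosh_add, Complex.cosh_mul_I, Complex.sinh_mul_I, ← Complex.ofReal_cos,
    ← Complex.ofReal_sin]
  simp [mul_comm]

theorem cosh_sub_pi_div_two_mul_I (u : ℝ) :
    Complex.cosh (u - (Real.pi / 2 : ℝ) * Complex.I) = -(Complex.I * Real.sinh u) := by
  rw [Complex.cosh_sub, Complex.cosh_mul_I, Complex.sinh_mul_I, ← Complex.ofReal_cos,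
    ← Complex.ofReal_sin]
  simp [mul_comm]

theorem sinh_sub_pi_div_two_mul_I (u : ℝ) :
    Complex.sinh (u - (Real.pi / 2 : ℝ) * Complex.I) = -(Complex.I * Real.cosh u) := by
  rw [Complex.sinh_sub, Complex.cosh_mul_I, Complex.sinh_mul_I, ← Complex.ofReal_cos,
    ← Complex.ofReal_sin]
  simp [mul_comm]

theorem integral_comp_sinh (F : ℝ → ℂ) :
    ∫ u : ℝ, (Real.cosh u : ℂ) * F (Real.sinh u) = ∫ η : ℝ, F η := by
  have h := integral_image_eq_integral_abs_deriv_smul (s := univ) MeasurableSet.univ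
    (fun s _ => (Real.hasDerivAt_sinh s).hasDerivWithinAt) Real.sinh_injective.injOn F
  rw [image_univ, Real.sinh_surjective.range_eq] at h
  simpa [abs_of_pos (Real.cosh_pos _)] using h.symm

/-- Fourier inversion for `z ↦ z⁻¹ exp (-(a z + b / z))` on the half line. -/
theorem integral_integral_expCosh_mul_exp {a b x : ℝ} (ha : 0 < a) (hb : 0 < b) (hx : 0 < x) :
    ∫ η : ℝ, (∫ s : ℝ, expCosh (a + Complex.I * η) b 0 s) * Complex.exp (Complex.I * η * x) =
      2 * Real.pi * (Real.exp (-(a * x + b / x)) / x : ℝ) := by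
  let r : ℝ → ℂ := fun z => ((Real.exp (-(a * z + b / z)) / z : ℝ) : ℂ)
  let h : ℝ → ℂ := (Ioi (0 : ℝ)).indicator r
  let R : ℝ → ℂ := fun η => ∫ s : ℝ, expCosh (a + Complex.I * η) b 0 s
  have hexp : ∀ s : ℝ, Real.exp s • ((Real.exp (-(a * Real.exp s + b / Real.exp s)) /
      Real.exp s : ℝ) : ℂ) = (Real.exp (-(a * Real.exp s + b * Real.exp (-s))) : ℝ) := fun s => by
    rw [Complex.real_smul, ← Complex.ofReal_mul, mul_div_cancel₀ _ (Real.exp_ne_zero s),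
      Real.exp_neg s, div_eq_mul_inv b]
  have hint : Integrable h := by
    rw [integrable_indicator_iff measurableSet_Ioi, integrableOn_Ioi_iff_integrable_comp_exp]
    simp only [r, hexp]
    exact (integrable_exp_neg_add ha hb).ofReal
  have hc : ContinuousAt h x := by
    have h1 : ContinuousAt r x := by
      unfold r
      have := hx.ne'
      fun_prop (disch := assumption)
    refine h1.congr ?_
    filter_upwards [Ioi_mem_nhds hx] with z hz
    exact (indicator_of_mem hz r).symm
  have hH : ∀ τ : ℝ, ∫ u : ℝ, h u * Complex.exp (Complex.I * τ * u) = R (-τ) := fun τ => by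
    have h1 : ∀ u : ℝ, h u * Complex.exp (Complex.I * τ * u) = (Ioi (0 : ℝ)).indicator
        (fun z => r z * Complex.exp (Complex.I * τ * z)) u :=
      fun u => (indicator_mul_left (Ioi 0) r fun z : ℝ => Complex.exp (Complex.I * τ * z)).symm
    simp only [h1]
    rw [integral_indicator measurableSet_Ioi, integral_Ioi_eq_integral_comp_exp]
    refine integral_congr_ae (ae_of_all _ fun s => ?_)
    simp only [r]
    rw [← smul_mul_assoc, hexp, expCosh, Complex.ofReal_exp, ← Complex.exp_add]
    congr 1
    push_cast
    ring
  -- Under `η = sinh u`, `R` is `coshLaplace` on the edge of the strip, and its decay `(cosh u)⁻²`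
  -- reads `1/(1 + η²)`.
  have hR : Integrable R := by
    obtain ⟨C, hC0, hC⟩ := exists_norm_coshLaplace_le ha hb
    refine (integrable_inv_one_add_sq.const_mul C).mono' ?_ (ae_of_all _ fun η => ?_)
    · refine (StronglyMeasurable.integral_prod_right (f := fun (η s : ℝ) =>
        expCosh (a + Complex.I * η) b 0 s) ?_).aestronglyMeasurable
      unfold expCosh
      exact Continuous.stronglyMeasurable (by fun_prop)
    · obtain ⟨u, rfl⟩ := Real.sinh_surjective η
      have := hC (Real.pi / 2) (by linarith [Real.pi_pos]) le_rfl u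
      rwa [coshLaplace, cosh_add_pi_div_two_mul_I, Real.cosh_sq'] at this
  have h3 := integral_mul_exp_neg_of_integral_mul_exp hint hc hH hR.comp_neg
  have h4 : h x = (Real.exp (-(a * x + b / x)) / x : ℝ) := indicator_of_mem (mem_Ioi.2 hx) r
  rw [← h4, ← h3, ← integral_neg_eq_self]
  refine integral_congr_ae (ae_of_all _ fun τ => ?_)
  simp only [R]
  congr 2
  push_cast
  ring

/-- On the edge `cosh(u + iπ/2) = i sinh u`, while `sinh(u - iπ/2) = -i cosh u` supplies the
Jacobian of `η = sinh u`. What remains is Fourier inversion at `x`. -/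
theorem integral_coshLaplace_pi_div_two {a b x : ℝ} (ha : 0 < a) (hb : 0 < b) (hx : 0 < x) :
    ∫ u : ℝ, coshLaplace a b (u + (Real.pi / 2 : ℝ) * Complex.I) *
      (Complex.I * Real.pi * (x * Complex.sinh (u - (Real.pi / 2 : ℝ) * Complex.I) *
        Complex.exp (-(x * Complex.cosh (u - (Real.pi / 2 : ℝ) * Complex.I))))) =
      2 * Real.pi ^ 2 * (Real.exp (-(a * x + b / x)) : ℝ) := by
  have h1 : ∀ u : ℝ, coshLaplace a b (u + (Real.pi / 2 : ℝ) * Complex.I) *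
      (Complex.I * Real.pi * (x * Complex.sinh (u - (Real.pi / 2 : ℝ) * Complex.I) *
        Complex.exp (-(x * Complex.cosh (u - (Real.pi / 2 : ℝ) * Complex.I))))) =
      Real.pi * x * ((Real.cosh u : ℂ) * ((∫ s : ℝ, expCosh (a + Complex.I * Real.sinh u) b 0 s) *
        Complex.exp (Complex.I * Real.sinh u * x))) := fun u => by
    rw [coshLaplace, cosh_add_pi_div_two_mul_I, cosh_sub_pi_div_two_mul_I,
      sinh_sub_pi_div_two_mul_I, show -((x : ℂ) * -(Complex.I * Real.sinh u)) =
        Complex.I * Real.sinh u * x by ring]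
    linear_combination (-(∫ s : ℝ, expCosh (a + Complex.I * Real.sinh u) b 0 s) * Real.pi * x *
      Real.cosh u * Complex.exp (Complex.I * Real.sinh u * x)) * Complex.I_sq
  simp only [h1]
  rw [integral_const_mul, integral_comp_sinh (fun η =>
    (∫ s : ℝ, expCosh (a + Complex.I * η) b 0 s) * Complex.exp (Complex.I * η * x)),
    integral_integral_expCosh_mul_exp ha hb hx]
  have : (x : ℂ) ≠ 0 := Complex.ofReal_ne_zero.2 hx.ne'
  push_cast
  field_simp

theorem integral_mul_exp_mul_macdonaldK_triple {x y t : ℝ} (hx : 0 < x) (hy : 0 < y)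
    (ht : 0 < t) :
    ∫ τ : ℝ, τ * Real.exp (Real.pi * τ) * (macdonaldK τ x * (macdonaldK τ y * macdonaldK τ t)) =
      Real.pi ^ 2 / 2 * klKernel x y t := by
  have ha : 0 < (y ^ 2 + t ^ 2) / (2 * y * t) := by positivity
  have hb : 0 < y * t / 2 := by positivity
  have hne : (nhdsWithin (Real.pi / 2) (Ioo (Real.pi / 4) (Real.pi / 2))).NeBot :=
    right_nhdsWithin_Ioo_neBot (by linarith [Real.pi_pos])
  have h1 := tendsto_integral_macdonaldK_triple hx hy ht
  have h2 := tendsto_integral_coshLaplace ha hb hx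
  -- The shifted identity holds for `δ < π/2`, so the limits of its two sides agree.
  have h3 := tendsto_nhds_unique (h1.congr' ?_) h2
  swap
  · filter_upwards [self_mem_nhdsWithin] with δ hδ
    refine integral_macdonaldK_triple_shift hx hy ht ?_
    rw [abs_of_pos (by linarith [hδ.1, Real.pi_pos])]
    exact hδ.2
  rw [integral_coshLaplace_pi_div_two ha hb hx] at h3
  have h4 : ∀ τ : ℝ, ((τ * Real.exp (Real.pi / 2 * τ) * macdonaldK τ x : ℝ) : ℂ) *
      (Real.exp (Real.pi / 2 * τ) * (4 * (macdonaldK τ y * macdonaldK τ t))) =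
      4 * ((τ * Real.exp (Real.pi * τ) *
        (macdonaldK τ x * (macdonaldK τ y * macdonaldK τ t)) : ℝ) : ℂ) := fun τ => by
    rw [show Real.pi * τ = Real.pi / 2 * τ + Real.pi / 2 * τ by ring, Real.exp_add]
    push_cast
    ring
  simp only [h4] at h3
  rw [integral_const_mul, integral_complex_ofReal] at h3
  norm_cast at h3
  have h5 : klKernel x y t =
      Real.exp (-((y ^ 2 + t ^ 2) / (2 * y * t) * x + y * t / 2 / x)) := by
    rw [klKernel]
    congr 1
    field_simp
    ring
  rw [h5]
  linarith

/-- The index integral of a product of three Macdonald functions. -/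
theorem integral_mul_sinh_mul_macdonaldK_triple {x y t : ℝ} (hx : 0 < x) (hy : 0 < y)
    (ht : 0 < t) :
    ∫ τ in Ioi (0 : ℝ), τ * Real.sinh (Real.pi * τ) *
      (macdonaldK τ x * (macdonaldK τ y * macdonaldK τ t)) = Real.pi ^ 2 / 4 * klKernel x y t := by
  have h1 := integral_mul_exp_mul_macdonaldK_triple hx hy ht
  obtain ⟨g, hg, hle⟩ := integrable_mul_exp_mul_triple hx hy ht
  have hint : Integrable fun τ : ℝ => τ * Real.exp (Real.pi * τ) *
      (macdonaldK τ x * (macdonaldK τ y * macdonaldK τ t)) := by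
    refine hg.mono' (Measurable.aestronglyMeasurable ?_) (ae_of_all _ fun τ => ?_)
    · have h1 := measurable_macdonaldK_index x
      have h2 := measurable_macdonaldK_index y
      have h3 := measurable_macdonaldK_index t
      fun_prop
    · refine le_trans ?_ (hle τ)
      simp only [norm_mul, Real.norm_eq_abs, Real.abs_exp]
      have h2 : 0 ≤ |macdonaldK τ x| * |macdonaldK τ y| * |macdonaldK τ t| := by positivity
      have h3 := le_abs_self τ
      have h4 := Real.pi_pos
      rw [← mul_assoc |macdonaldK τ x|]
      refine mul_le_mul ?_ (by linarith) h2 (by positivity)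
      gcongr
  -- `K_{iτ}` is even in `τ`, so adding the reflected integrand replaces `e^{πτ}` by `2 sinh(πτ)`,
  -- and the sum is even.
  have h2 := integral_add hint hint.comp_neg
  rw [integral_neg_eq_self (fun τ : ℝ => τ * Real.exp (Real.pi * τ) *
      (macdonaldK τ x * (macdonaldK τ y * macdonaldK τ t))), h1] at h2
  have h3 : ∀ τ : ℝ, τ * Real.exp (Real.pi * τ) *
      (macdonaldK τ x * (macdonaldK τ y * macdonaldK τ t)) + -τ * Real.exp (Real.pi * -τ) *
      (macdonaldK (-τ) x * (macdonaldK (-τ) y * macdonaldK (-τ) t)) =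
      2 * (|τ| * Real.sinh (Real.pi * |τ|) *
        (macdonaldK |τ| x * (macdonaldK |τ| y * macdonaldK |τ| t))) := fun τ => by
    rcases abs_choice τ with h | h <;> rw [h]
    · simp only [macdonaldK_neg, Real.sinh_eq]
      ring_nf
    · simp only [macdonaldK_neg, Real.sinh_eq, mul_neg, neg_neg]
      ring_nf
  simp only [h3] at h2
  rw [integral_const_mul, integral_comp_abs (f := fun τ => τ * Real.sinh (Real.pi * τ) *
        (macdonaldK τ x * (macdonaldK τ y * macdonaldK τ t)))] at h2
  linarith

/-! ### The index integral for `p < 1/2`. -/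

/-- Completing squares shows that the negated exponent is at least `y` and at least `t`, hence at
least their mean. -/
theorem klKernel_le_exp_neg {x y t : ℝ} (hx : 0 < x) (hy : 0 < y) (ht : 0 < t) :
    klKernel x y t ≤ Real.exp (-(1 / 2 * y)) * Real.exp (-(1 / 2 * t)) := by
  rw [klKernel, ← Real.exp_add, Real.exp_le_exp]
  have h1 : (y ^ 2 + t ^ 2) / (2 * y * t) * x + y * t / (2 * x) - y =
      y * (x - t) ^ 2 / (2 * x * t) + t * x / (2 * y) := by
    field_simp
    ring
  have h2 : (y ^ 2 + t ^ 2) / (2 * y * t) * x + y * t / (2 * x) - t =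
      t * (x - y) ^ 2 / (2 * x * y) + y * x / (2 * t) := by
    field_simp
    ring
  have h3 : 0 ≤ y * (x - t) ^ 2 / (2 * x * t) + t * x / (2 * y) := by positivity
  have h4 : 0 ≤ t * (x - y) ^ 2 / (2 * x * y) + y * x / (2 * t) := by positivity
  linarith

theorem mul_exp_neg_mul_cosh_le_macdonaldK_zero {x ε : ℝ} (hx : 0 < x) (hε : 0 ≤ ε) :
    ε * Real.exp (-x * Real.cosh ε) ≤ macdonaldK 0 x := by
  rw [macdonaldK_zero_eq]
  have hint := (integrable_exp_neg_mul_cosh hx)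
  calc ε * Real.exp (-x * Real.cosh ε) = ∫ _ in Ioc 0 ε, Real.exp (-x * Real.cosh ε) := by
        simp [hε]
    _ ≤ ∫ u in Ioc 0 ε, Real.exp (-x * Real.cosh u) := by
        refine setIntegral_mono_on (by simp) hint.integrableOn measurableSet_Ioc fun u hu => ?_
        have : Real.cosh u ≤ Real.cosh ε := by
          rw [Real.cosh_le_cosh, abs_of_pos hu.1, abs_of_nonneg hε]
          exact hu.2
        rw [Real.exp_le_exp]
        nlinarith
    _ ≤ _ := setIntegral_mono_set hint.integrableOn (ae_of_all _ fun u => (Real.exp_pos _).le)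
        (Filter.Eventually.of_forall Ioc_subset_Ioi_self)

theorem exists_exp_neg_half_mul_le {p : ℝ} (hp0 : 0 < p) (hp : p < 1 / 2) :
    ∃ C : ℝ, 0 ≤ C ∧ ∀ z, 0 < z → Real.exp (-(1 / 2 * z)) ≤ C * macdonaldK 0 (p * z) := by
  -- For `p < 1/2` there is `ε > 0` with `cosh ε = 1/(2p)`; the part of the integral for `K_0(pz)`
  -- over `(0, ε]` is then at least `ε e^{-z/2}`.
  have h1 : 1 < (2 * p)⁻¹ := (one_lt_inv₀ (by positivity)).2 (by linarith)
  have hε := Real.arcosh_pos h1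
  refine ⟨(Real.arcosh (2 * p)⁻¹)⁻¹, inv_nonneg.2 hε.le, fun z hz => ?_⟩
  have h2 := mul_exp_neg_mul_cosh_le_macdonaldK_zero (mul_pos hp0 hz) hε.le
  rw [Real.cosh_arcosh h1.le] at h2
  have h3 : -(p * z) * (2 * p)⁻¹ = -(1 / 2 * z) := by field_simp
  rw [h3] at h2
  rwa [inv_mul_eq_div, le_div_iff₀' hε]

section Index

variable {p : ℝ} {f g : ℝ → ℂ}

theorem integrableOn_klConvIntegrand_of_lt_half (hp0 : 0 < p) (hp : p < 1 / 2)
    (hf : MemLp f 1 (macdonaldMeasure p)) (hg : MemLp g 1 (macdonaldMeasure p)) {x : ℝ}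
    (hx : 0 < x) : IntegrableOn (klConvIntegrand f g x) (Ioi 0 ×ˢ Ioi 0) := by
  obtain ⟨C, hC0, hC⟩ := exists_exp_neg_half_mul_le hp0 hp
  have hI := ((integrableOn_macdonaldK_zero_mul hp0 hf).mul_prod
    (integrableOn_macdonaldK_zero_mul hp0 hg)).norm.const_mul (C * C)
  rw [← volume_restrict_Ioi_prod_Ioi] at hI
  refine hI.mono' ?_ ((ae_restrict_iff' (measurableSet_Ioi.prod measurableSet_Ioi)).2
    (ae_of_all _ ?_))
  · rw [volume_restrict_Ioi_prod_Ioi]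
    change AEStronglyMeasurable
      (fun z : ℝ × ℝ => (klKernel x z.1 z.2 : ℂ) * (f z.1 * g z.2)) _
    refine AEStronglyMeasurable.mul ?_
      ((aestronglyMeasurable_of_macdonaldMeasure hp0 hf.1).comp_fst.mul
        (aestronglyMeasurable_of_macdonaldMeasure hp0 hg.1).comp_snd)
    exact (Complex.measurable_ofReal.comp
      (measurable_klKernel.comp measurable_prodMk_left)).aestronglyMeasurable
  · rintro ⟨y, t⟩ ⟨hy : 0 < y, ht : 0 < t⟩
    have h1 := macdonaldK_zero_pos (mul_pos hp0 hy)
    have h2 := macdonaldK_zero_pos (mul_pos hp0 ht)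
    simp only [klConvIntegrand_eq, norm_mul, Complex.norm_real, Real.norm_eq_abs,
      abs_of_pos h1, abs_of_pos h2, abs_of_pos (klKernel_pos x y t)]
    calc _ ≤ ((C * macdonaldK 0 (p * y)) * (C * macdonaldK 0 (p * t))) * (‖f y‖ * ‖g t‖) := by
          gcongr
          refine (klKernel_le_exp_neg hx hy ht).trans ?_
          have := hC y hy
          have := hC t ht
          gcongr
      _ = _ := by ring

/-- The integrand of the triple integral whose two iterated integrals give the index integral and
the convolution. -/
noncomputable def klTripleIntegrand (f g : ℝ → ℂ) (x : ℝ) (w : ℝ × ℝ × ℝ) : ℂ :=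
  ((w.1 * Real.sinh (Real.pi * w.1) * macdonaldK w.1 x : ℝ) : ℂ) *
    ((macdonaldK w.1 w.2.1 * f w.2.1) * (macdonaldK w.1 w.2.2 * g w.2.2))

theorem integral_klTripleIntegrand (f g : ℝ → ℂ) (x τ : ℝ) :
    ∫ z, klTripleIntegrand f g x (τ, z)
      ∂((volume.restrict (Ioi (0 : ℝ))).prod (volume.restrict (Ioi (0 : ℝ)))) =
      klIndexIntegrand f g x τ := by
  simp only [klTripleIntegrand, klIndexIntegrand]
  rw [integral_const_mul, integral_prod_mul (fun y : ℝ => (macdonaldK τ y : ℂ) * f y)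
    (fun t : ℝ => (macdonaldK τ t : ℂ) * g t)]
  rfl

theorem abs_sinh_pi_mul_le (τ : ℝ) : |Real.sinh (Real.pi * τ)| ≤ Real.exp (Real.pi * |τ|) := by
  rw [Real.abs_sinh, abs_mul, abs_of_pos Real.pi_pos]
  have h1 := Real.cosh_add_sinh (Real.pi * |τ|)
  have h2 := Real.cosh_pos (Real.pi * |τ|)
  linarith

theorem aestronglyMeasurable_klTripleIntegrand (x : ℝ)
    (hf : AEStronglyMeasurable f (volume.restrict (Ioi 0)))
    (hg : AEStronglyMeasurable g (volume.restrict (Ioi 0))) :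
    AEStronglyMeasurable (klTripleIntegrand f g x) ((volume.restrict (Ioi 0)).prod
      ((volume.restrict (Ioi 0)).prod (volume.restrict (Ioi 0)))) := by
  have h1 := measurable_macdonaldK_index x
  have h2 : Measurable fun w : ℝ × ℝ × ℝ => (macdonaldK w.1 w.2.1 : ℂ) :=
    Complex.measurable_ofReal.comp (stronglyMeasurable_macdonaldK.measurable.comp
      (by fun_prop : Measurable fun w : ℝ × ℝ × ℝ => (w.1, w.2.1)))
  have h3 : Measurable fun w : ℝ × ℝ × ℝ => (macdonaldK w.1 w.2.2 : ℂ) :=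
    Complex.measurable_ofReal.comp (stronglyMeasurable_macdonaldK.measurable.comp
      (by fun_prop : Measurable fun w : ℝ × ℝ × ℝ => (w.1, w.2.2)))
  refine AEStronglyMeasurable.mul (Measurable.aestronglyMeasurable (by fun_prop))
    ((h2.aestronglyMeasurable.mul ?_).mul (h3.aestronglyMeasurable.mul ?_))
  · exact AEStronglyMeasurable.comp_snd hf.comp_fst
  · exact AEStronglyMeasurable.comp_snd hg.comp_snd

theorem integrable_klTripleIntegrand (hp0 : 0 < p) (hp : p < 1 / 2)
    (hf : MemLp f 1 (macdonaldMeasure p)) (hg : MemLp g 1 (macdonaldMeasure p)) {x : ℝ}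
    (hx : 0 < x) : Integrable (klTripleIntegrand f g x) ((volume.restrict (Ioi 0)).prod
      ((volume.restrict (Ioi 0)).prod (volume.restrict (Ioi 0)))) := by
  -- This angle makes the decay bounds involve exactly the weight `K_0(p ·)`, and `p < 1/2` says
  -- that it exceeds `π/3`.
  set δ := Real.arccos p with hδdef
  have hcos : Real.cos δ = p := Real.cos_arccos (by linarith) (by linarith)
  have hδ2 : |δ| < Real.pi / 2 := by
    rw [abs_of_nonneg (Real.arccos_nonneg p)]
    exact Real.arccos_lt_pi_div_two.2 hp0
  have hδ3 : Real.pi / 3 < δ := by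
    by_contra! h
    have h1 := Real.cos_le_cos_of_nonneg_of_le_pi (Real.arccos_nonneg p)
      (by linarith [Real.pi_pos]) h
    rw [hcos, Real.cos_pi_div_three] at h1
    linarith
  have hI := ((integrable_abs_mul_exp_mul_exp_pow_three hδ3).restrict (s := Ioi 0)).mul_prod
    ((integrableOn_macdonaldK_zero_mul hp0 hf).mul_prod
      (integrableOn_macdonaldK_zero_mul hp0 hg)).norm
  refine (hI.const_mul (macdonaldK 0 (p * x))).mono' (aestronglyMeasurable_klTripleIntegrand x
    (aestronglyMeasurable_of_macdonaldMeasure hp0 hf.1)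
    (aestronglyMeasurable_of_macdonaldMeasure hp0 hg.1)) ?_
  have h : ∀ᵐ w : ℝ × ℝ × ℝ ∂((volume.restrict (Ioi (0 : ℝ))).prod
      ((volume.restrict (Ioi (0 : ℝ))).prod (volume.restrict (Ioi (0 : ℝ))))),
      w.2 ∈ Ioi (0 : ℝ) ×ˢ Ioi (0 : ℝ) := by
    refine Measure.quasiMeasurePreserving_snd.ae ?_
    rw [← volume_restrict_Ioi_prod_Ioi]
    exact ae_restrict_mem (measurableSet_Ioi.prod measurableSet_Ioi)
  filter_upwards [h]
  rintro ⟨τ, y, t⟩ ⟨hy : 0 < y, ht : 0 < t⟩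
  have k1 := macdonaldK_zero_pos (mul_pos hp0 hy)
  have k2 := macdonaldK_zero_pos (mul_pos hp0 ht)
  have k3 := macdonaldK_zero_pos (mul_pos hp0 hx)
  have b1 := abs_macdonaldK_le_mul_exp hy hδ2 τ
  have b2 := abs_macdonaldK_le_mul_exp ht hδ2 τ
  have b3 := abs_macdonaldK_le_mul_exp hx hδ2 τ
  rw [hcos, mul_comm _ p] at b1 b2 b3
  simp only [klTripleIntegrand, norm_mul, Complex.norm_real, Real.norm_eq_abs, abs_of_pos k1,
    abs_of_pos k2]
  calc _ ≤ |τ| * Real.exp (Real.pi * |τ|) * (macdonaldK 0 (p * x) * Real.exp (-(δ * |τ|))) *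
        ((macdonaldK 0 (p * y) * Real.exp (-(δ * |τ|)) * ‖f y‖) *
          (macdonaldK 0 (p * t) * Real.exp (-(δ * |τ|)) * ‖g t‖)) := by
        have := abs_sinh_pi_mul_le τ
        gcongr
    _ = _ := by ring

theorem integrableOn_klIndexIntegrand (hp0 : 0 < p) (hp : p < 1 / 2)
    (hf : MemLp f 1 (macdonaldMeasure p)) (hg : MemLp g 1 (macdonaldMeasure p)) {x : ℝ}
    (hx : 0 < x) : IntegrableOn (klIndexIntegrand f g x) (Ioi 0) := by
  have h := (integrable_klTripleIntegrand hp0 hp hf hg hx).integral_prod_left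
  simp only [integral_klTripleIntegrand] at h
  exact h

theorem klConv_eq_integral_klIndexIntegrand (hp0 : 0 < p) (hp : p < 1 / 2)
    (hf : MemLp f 1 (macdonaldMeasure p)) (hg : MemLp g 1 (macdonaldMeasure p)) {x : ℝ}
    (hx : 0 < x) : klConv f g x =
      2 / ((x : ℂ) * (Real.pi : ℂ) ^ 2) * ∫ τ in Ioi (0 : ℝ), klIndexIntegrand f g x τ := by
  have h1 : ∫ τ in Ioi (0 : ℝ), klIndexIntegrand f g x τ =
      (Real.pi : ℂ) ^ 2 / 4 * ∫ z in Ioi 0 ×ˢ Ioi 0, klConvIntegrand f g x z := by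
    simp only [← integral_klTripleIntegrand]
    -- With the index integrated first, each `(y, t)` contributes `π²/4` times the kernel.
    rw [integral_integral_swap (f := fun τ z => klTripleIntegrand f g x (τ, z))
      (integrable_klTripleIntegrand hp0 hp hf hg hx), ← volume_restrict_Ioi_prod_Ioi,
      ← integral_const_mul]
    refine setIntegral_congr_fun (measurableSet_Ioi.prod measurableSet_Ioi) ?_
    rintro ⟨y, t⟩ ⟨hy : 0 < y, ht : 0 < t⟩
    have h2 : ∀ τ : ℝ, klTripleIntegrand f g x (τ, y, t) =
        ((τ * Real.sinh (Real.pi * τ) *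
          (macdonaldK τ x * (macdonaldK τ y * macdonaldK τ t)) : ℝ) : ℂ) * (f y * g t) :=
      fun τ => by
        rw [klTripleIntegrand]
        push_cast
        ring
    simp only [h2]
    rw [integral_mul_const, integral_complex_ofReal,
      integral_mul_sinh_mul_macdonaldK_triple hx hy ht, klConvIntegrand_eq]
    push_cast
    ring
  have hx0 : (x : ℂ) ≠ 0 := Complex.ofReal_ne_zero.2 hx.ne'
  have hpi : (Real.pi : ℂ) ≠ 0 := Complex.ofReal_ne_zero.2 Real.pi_ne_zero
  rw [h1, klConv]
  field_simp
  ring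

end Index

theorem theorem1 (p : ℝ) (hp0 : 0 < p) (hp1 : p ≤ 1) (f g : ℝ → ℂ)
    (hf : MemLp f 1 (macdonaldMeasure p)) (hg : MemLp g 1 (macdonaldMeasure p)) :
    -- the double integral defining the convolution converges absolutely for almost every x > 0
    (∀ᵐ x ∂(volume.restrict (Ioi (0 : ℝ))),
      IntegrableOn (klConvIntegrand f g x) (Ioi (0 : ℝ) ×ˢ Ioi (0 : ℝ))) ∧
    -- the convolution is in the space with weight K_0(p² x), with the Young-type inequality
    MemLp (klConv f g) 1 (macdonaldMeasure (p ^ 2)) ∧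
    eLpNorm (klConv f g) 1 (macdonaldMeasure (p ^ 2)) ≤
      eLpNorm f 1 (macdonaldMeasure p) * eLpNorm g 1 (macdonaldMeasure p) ∧
    -- the three transforms converge absolutely and the product formula holds
    (∀ τ : ℝ, 0 < τ →
      IntegrableOn (fun x => (macdonaldK τ x : ℂ) * f x) (Ioi (0 : ℝ)) ∧
      IntegrableOn (fun x => (macdonaldK τ x : ℂ) * g x) (Ioi (0 : ℝ)) ∧
      IntegrableOn (fun x => (macdonaldK τ x : ℂ) * klConv f g x) (Ioi (0 : ℝ)) ∧
      klTransform (klConv f g) τ = klTransform f τ * klTransform g τ) ∧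
    -- for p < 1/2 the Parseval-type equality holds at every x > 0, both sides converging absolutely
    (p < 1 / 2 → ∀ x : ℝ, 0 < x →
      IntegrableOn (klConvIntegrand f g x) (Ioi (0 : ℝ) ×ˢ Ioi (0 : ℝ)) ∧
      IntegrableOn (klIndexIntegrand f g x) (Ioi (0 : ℝ)) ∧
      klConv f g x =
        2 / ((x : ℂ) * (Real.pi : ℂ) ^ 2) * ∫ τ in Ioi (0 : ℝ), klIndexIntegrand f g x τ) := by
  have hmem := memLp_klConv hp0 hp1 hf hg
  refine ⟨ae_integrableOn_klConvIntegrand hp0 hp1 hf hg, hmem, eLpNorm_klConv_le hp0 hp1 hf hg,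
    fun τ _ => ⟨integrableOn_macdonaldK_mul hp0 hp1 hf τ, integrableOn_macdonaldK_mul hp0 hp1 hg τ,
      integrableOn_macdonaldK_mul (pow_pos hp0 2) (pow_le_one₀ hp0.le hp1) hmem τ,
      klTransform_klConv hp0 hp1 hf hg τ⟩,
    fun hp x hx => ⟨integrableOn_klConvIntegrand_of_lt_half hp0 hp hf hg hx,
      integrableOn_klIndexIntegrand hp0 hp hf hg hx,
      klConv_eq_integral_klIndexIntegrand hp0 hp hf hg hx⟩⟩
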